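/- **Conventions.** $R$ is a commutative noetherian local ring with residue field $k$; modules are right modules. For an $R$-module $M$ put $\operatorname{depth}_R M=\inf\{i\mid \operatorname{Ext}^i_R(k,M)\neq 0\}$. A finitely generated $R$-module $M$ is *maximal Cohen–Macaulay* (maximal CM) if $\operatorname{depth}_R M\ge \dim R$, and *small CM* if moreover $M\neq 0$; $R$ is a *CM local ring* if it is small CM over itself. A *canonical module* $\omega_R$ is a small CM $R$-module of finite injective dimension such that the homothety map $R\to \operatorname{End}_R(\omega_R)$ is bijective and $\operatorname{Ext}_R^i(\omega_R,\omega_R)=0$ for all $i>0$ (i.e. it is a dualizing complex). An *$R$-order* is a module-finite $R$-algebra $A$ that is small CM as an $R$-module. It is *Gorenstein* if $\operatorname{Hom}_R(A,\omega_R)$ is projective as a right $A$-module. An $A$-module is maximal CM if it is so over $R$. A module $M$ over a ring $A$ is *Gorenstein-projective* if $M\cong\operatorname{Ker}(X^0\to X^1)$ for some acyclic complex $X$ of projective $A$-modules such that $\operatorname{Hom}_A(X,P)$ is acyclic for every projective $A$-module $P$. The stable category $\underline{\mathrm{GProj}}\,A$ has the Gorenstein-projective $A$-modules as objects, and its morphisms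 are the $A$-homomorphisms modulo those factoring through a projective module; it is triangulated, with distinguished triangles arising from the short exact sequences of Gorenstein-projective modules. An $A$-module $P$ is *pure-injective in* $\operatorname{Mod}A$ if every homomorphism $M\to P$ extends along every pure monomorphism $M\to N$; a monomorphism $f$ is pure if every homomorphism from a finitely presented module to $\operatorname{Coker} f$ lifts to $N$. An object $C$ of $\mathcal T=\underline{\mathrm{GProj}}\,A$ is *compact* if $\operatorname{Hom}_{\mathcal T}(C,-)$ commutes with small direct sums. An object $X$ is *pure-injective in* $\mathcal T$ if every distinguished triangle $X\to Y\to Z\to\Sigma X$ splits for which $0\to\operatorname{Hom}_{\mathcal T}(C,X)\to\operatorname{Hom}_{\mathcal T}(C,Y)\to\operatorname{Hom}_{\mathcal T}(C,Z)\to0$ is exact for every compact $C$. **Lemma.** Let $R$ be a CM local ring with a canonical module $\omega_R$ and let $A$ be a Gorenstein $R$-order. 1. If a Gorenstein-projective $A$-module $M$ is pure-injective in $\operatorname{Mod}A$, then $M$ is pure-injective in $\underline{\mathrm{GProj}}\,A$. 2. If $R$ is complete (with respect to its maximal ideal), then every maximal CM $A$-module is Gorenstein-projective and is pure-injective in $\underline{\mathrm{GProj}}\,A$.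 -/

import Mathlib

open CategoryTheory Limits
open scoped MulOpposite DomMulAct ZeroObject

universe u

namespace GorOrd

/-! ### Commutative algebra: depth, maximal Cohen-Macaulay modules, canonical modules -/

section Commutative

variable (R : Type u) [CommRing R] [IsLocalRing R]

/-- The depth `inf {i | Ext^i_R(k, M) ≠ 0}` of an `R`-module `M`, where `k` is the residue field;
it is `⊤` when all these groups vanish. -/
noncomputable def depth (M : ModuleCat.{u} R) : ℕ∞ :=
  ⨅ (i : ℕ) (_ : Nontrivial (Abelian.Ext (ModuleCat.of R (IsLocalRing.ResidueField R)) M i)),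
    (i : ℕ∞)

/-- Maximal Cohen-Macaulay modules: finitely generated with `depth M ≥ dim R`
(the zero module is allowed). -/
structure IsMaximalCM (M : ModuleCat.{u} R) : Prop where
  finite : Module.Finite R M
  dim_le_depth : ringKrullDim R ≤ ((depth R M : ℕ∞) : WithBot ℕ∞)

/-- Small Cohen-Macaulay modules: nonzero maximal Cohen-Macaulay modules. -/
structure IsSmallCM (M : ModuleCat.{u} R) : Prop extends IsMaximalCM R M where
  nontrivial : Nontrivial M

/-- Cohen-Macaulay local rings. -/
structure IsCMLocalRing : Prop where
  isNoetherianRing : IsNoetherianRing R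
  isSmallCM : IsSmallCM R (ModuleCat.of R R)

/-- A canonical module: a small Cohen-Macaulay module which is a dualizing complex, that is,
it has finite injective dimension and the homothety morphism `R → RHom_R(ω, ω)` is an
isomorphism. -/
structure IsCanonicalModule (ω : ModuleCat.{u} R) : Prop extends IsSmallCM R ω where
  finite_injDim : ∃ n : ℕ, HasInjectiveDimensionLT ω n
  homothety_bijective : Function.Bijective (algebraMap R (Module.End R ω))
  ext_self_eq_zero : ∀ i : ℕ, 0 < i → Subsingleton (Abelian.Ext ω ω i)

end Commutative

/-! ### Orders -/

section Orders

variable (R A : Type u) [CommRing R] [IsLocalRing R] [Ring A] [Algebra R A]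

/-- An `R`-order: a module-finite `R`-algebra that is small Cohen-Macaulay over `R`. -/
def IsOrder : Prop := IsSmallCM R (ModuleCat.of R A)

/-- Given a canonical module `ω` of `R`, an `R`-order `A` is Gorenstein if
`ω_A = Hom_R(A, ω)` is projective as a right `A`-module. Here `Aᵈᵐᵃ` is the opposite ring of `A`,
acting on `Hom_R(A, ω)` by precomposition: `(f · a) x = f (a * x)`. -/
structure IsGorensteinOrder (ω : ModuleCat.{u} R) : Prop where
  isOrder : IsOrder R A
  projective : Module.Projective Aᵈᵐᵃ (A →ₗ[R] ω)

/-- A right `A`-module (a module over `Aᵐᵒᵖ`) is maximal Cohen-Macaulay if it is so over `R`.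
(Since it is finitely generated over `R`, it is finitely generated over `A`.) -/
def IsMaximalCMModule (M : ModuleCat.{u} Aᵐᵒᵖ) : Prop :=
  IsMaximalCM R ((ModuleCat.restrictScalars (algebraMap R Aᵐᵒᵖ)).obj M)

end Orders

/-! ### Purity in module categories -/

section ModulePurity

variable (S : Type u) [Ring S]

/-- Pure monomorphisms of `S`-modules: for each finitely presented `F`, the sequence
`0 → Hom(F, M) → Hom(F, N) → Hom(F, Coker f) → 0` is exact. -/
def IsPureMono {M N : Type u} [AddCommGroup M] [AddCommGroup N] [Module S M] [Module S N]
    (f : M →ₗ[S] N) : Prop :=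
  Function.Injective f ∧
    ∀ (F : Type u) [AddCommGroup F] [Module S F] [Module.FinitePresentation S F]
      (g : F →ₗ[S] N ⧸ LinearMap.range f),
      ∃ g' : F →ₗ[S] N, (LinearMap.range f).mkQ ∘ₗ g' = g

/-- Pure-injective `S`-modules: morphisms to `P` extend along pure monomorphisms. -/
def IsPureInjectiveModule (P : Type u) [AddCommGroup P] [Module S P] : Prop :=
  ∀ (M N : Type u) [AddCommGroup M] [AddCommGroup N] [Module S M] [Module S N]
    (f : M →ₗ[S] N), IsPureMono S f → ∀ g : M →ₗ[S] P, ∃ g' : N →ₗ[S] P, g' ∘ₗ f = g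

end ModulePurity

/-! ### Gorenstein-projective modules and their stable category -/

section Stable

variable (S : Type u) [Ring S]

/-- Totally acyclic complexes of projective `S`-modules: `X` is acyclic, and `Hom(X, P)` is
acyclic for each projective module `P`. -/
structure IsTotallyAcyclic (X : CochainComplex (ModuleCat.{u} S) ℤ) : Prop where
  projective : ∀ i, Projective (X.X i)
  exact : ∀ i, X.ExactAt i
  hom_exact : ∀ (P : ModuleCat.{u} S), Projective P → ∀ (i j k : ℤ), i + 1 = j → j + 1 = k →
    ∀ f : X.X j ⟶ P, X.d i j ≫ f = 0 → ∃ g : X.X k ⟶ P, X.d j k ≫ g = f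

/-- Gorenstein-projective `S`-modules: modules isomorphic to `Ker (X⁰ → X¹)` for some totally
acyclic complex `X` of projective modules. -/
def IsGorensteinProjective : ObjectProperty (ModuleCat.{u} S) := fun M =>
  ∃ X : CochainComplex (ModuleCat.{u} S) ℤ, IsTotallyAcyclic S X ∧
    Nonempty (M ≅ kernel (X.d 0 1))

/-- The category of Gorenstein-projective `S`-modules. -/
abbrev GProj := (IsGorensteinProjective S).FullSubcategory

/-- Two morphisms are identified in the stable category when their difference factors through a
projective module. -/
def stableRel : HomRel (GProj S) := fun X Y f g =>
  ∃ (P : ModuleCat.{u} S) (_ : Projective P) (a : X.obj ⟶ P) (b : P ⟶ Y.obj),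
    a ≫ b = f.hom - g.hom

variable {S}

lemma stableRel_add ⦃X Y : GProj S⦄ (f₁ f₂ g₁ g₂ : X ⟶ Y) (hf : stableRel S f₁ f₂)
    (hg : stableRel S g₁ g₂) : stableRel S (f₁ + g₁) (f₂ + g₂) := by
  obtain ⟨P, hP, a, b, h⟩ := hf
  obtain ⟨Q, hQ, c, d, k⟩ := hg
  refine ⟨P ⊞ Q, inferInstance, biprod.lift a c, biprod.desc b d, ?_⟩
  rw [biprod.lift_desc, h, k]
  change _ = (f₁.hom + g₁.hom) - (f₂.hom + g₂.hom)
  abel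

instance : Congruence (stableRel S) where
  equivalence := fun {X Y} =>
    { refl := fun f => ⟨0, inferInstance, 0, 0, by simp⟩
      symm := by
        rintro f g ⟨P, hP, a, b, h⟩
        exact ⟨P, hP, -a, b, by simp [h]⟩
      trans := by
        rintro f g k h₁ h₂
        obtain ⟨P, hP, a, b, h⟩ := stableRel_add _ _ _ _ h₁ h₂
        refine ⟨P, hP, a, b, h.trans ?_⟩
        change (f.hom + g.hom) - (g.hom + k.hom) = _
        abel }
  comp_left := by
    rintro X Y Z f g g' ⟨P, hP, a, b, h⟩
    exact ⟨P, hP, f.hom ≫ a, b, by simp [h]⟩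
  comp_right := by
    rintro X Y Z f f' g ⟨P, hP, a, b, h⟩
    exact ⟨P, hP, a, b ≫ g.hom, by simp [reassoc_of% h]⟩

variable (S)

/-- The stable category of Gorenstein-projective `S`-modules: same objects as `GProj S`, and
morphisms are taken modulo those that factor through a projective module. -/
abbrev StableGProj := CategoryTheory.Quotient (stableRel S)

noncomputable instance : Preadditive (StableGProj S) :=
  Quotient.preadditive (stableRel S) stableRel_add

/-- The canonical functor from Gorenstein-projective modules to their stable category. -/
abbrev stab : GProj S ⥤ StableGProj S := Quotient.functor (stableRel S)

variable {S}

lemma IsTotallyAcyclic.shift {X : CochainComplex (ModuleCat.{u} S) ℤ}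
    (h : IsTotallyAcyclic S X) (n : ℤ) : IsTotallyAcyclic S (X⟦n⟧) where
  projective i := h.projective (i + n)
  exact i := by
    have := h.exact (i + n)
    rw [HomologicalComplex.exactAt_iff_isZero_homology] at this ⊢
    exact this.of_iso (((HomologicalComplex.homologyFunctor (ModuleCat.{u} S)
      (ComplexShape.up ℤ) 0).shiftIso n i (i + n) (by ring)).app X)
  hom_exact P hP i j k hij hjk f hf := by
    change X.X (j + n) ⟶ P at f
    change (n.negOnePow • X.d (i + n) (j + n) : X.X (i + n) ⟶ X.X (j + n)) ≫ f = 0 at hf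
    obtain ⟨g, hg⟩ := h.hom_exact P hP (i + n) (j + n) (k + n) (by lia) (by lia) f (by
      rw [Linear.units_smul_comp] at hf
      exact (smul_eq_zero_iff_eq _).1 hf)
    refine ⟨(n.negOnePow • g : X.X (k + n) ⟶ P), ?_⟩
    change (n.negOnePow • X.d (j + n) (k + n) : X.X (j + n) ⟶ X.X (k + n)) ≫
      (n.negOnePow • g : X.X (k + n) ⟶ P) = f
    rw [Linear.units_smul_comp, Linear.comp_units_smul, smul_smul, Int.units_mul_self, one_smul,
      hg]

/-- A short exact sequence `0 → X → Q → W → 0` with `X`, `W` Gorenstein-projective and `Q`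
projective (hence Gorenstein-projective). -/
structure SuspensionData (X : GProj S) where
  Q : ModuleCat.{u} S
  W : GProj S
  i : X.obj ⟶ Q
  p : Q ⟶ W.obj
  projective : Projective Q
  zero : i ≫ p = 0
  shortExact : (ShortComplex.mk i p zero).ShortExact

lemma nonempty_suspensionData (X : GProj S) : Nonempty (SuspensionData X) := by
  obtain ⟨M, C, hC, ⟨e⟩⟩ := X
  have h0 := (C.exactAt_iff' 0 1 2 (by simp) (by simp)).1 (hC.exact 1)
  have hepi : Epi (kernel.lift (C.d 1 2) (C.d 0 1) (C.d_comp_d 0 1 2)) :=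
    (ShortComplex.exact_iff_epi_kernel_lift _).1 h0
  have hd : (kernel ((C⟦(1 : ℤ)⟧).d 0 1)) = kernel (-C.d 1 2) := by
    have : (C⟦(1 : ℤ)⟧).d 0 1 = (-C.d 1 2 : C.X 1 ⟶ C.X 2) := by
      change (Int.negOnePow 1 • C.d 1 2 : C.X 1 ⟶ C.X 2) = _
      simp
    exact congrArg (fun f : C.X 1 ⟶ C.X 2 => kernel f) this
  have hW : IsGorensteinProjective S (kernel (C.d 1 2)) :=
    ⟨C⟦(1 : ℤ)⟧, hC.shift 1, ⟨kernel.mapIso (C.d 1 2) (-C.d 1 2) (Iso.refl _)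
      ⟨-𝟙 _, -𝟙 _, by simp, by simp⟩ (by simp) ≪≫ eqToIso hd.symm⟩⟩
  have w : (e.hom ≫ kernel.ι (C.d 0 1)) ≫
      kernel.lift (C.d 1 2) (C.d 0 1) (C.d_comp_d 0 1 2) = 0 := by
    rw [← cancel_mono (kernel.ι _)]
    simp
  refine ⟨⟨C.X 0, ⟨_, hW⟩, e.hom ≫ kernel.ι _, kernel.lift _ (C.d 0 1) (C.d_comp_d 0 1 2),
    hC.projective 0, w, ?_⟩⟩
  refine { exact := ?_, mono_f := ?_, epi_g := hepi }
  · let φ : ShortComplex.mk _ _ w ⟶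
        ShortComplex.mk (kernel.ι (C.d 0 1)) (C.d 0 1) (kernel.condition _) :=
      { τ₁ := e.hom, τ₂ := 𝟙 _, τ₃ := kernel.ι (C.d 1 2) }
    have h₁ : Epi φ.τ₁ := inferInstanceAs (Epi e.hom)
    have h₂ : IsIso φ.τ₂ := inferInstanceAs (IsIso (𝟙 _))
    have h₃ : Mono φ.τ₃ := inferInstanceAs (Mono (kernel.ι (C.d 1 2)))
    exact (ShortComplex.exact_iff_of_epi_of_isIso_of_mono φ).2 (ShortComplex.exact_kernel _)
  · dsimp; infer_instance

/-- A chosen short exact sequence `0 → X → Q → W → 0` as above. -/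
noncomputable def suspData (X : GProj S) : SuspensionData X := (nonempty_suspensionData X).some

/-- The suspension `ΣX` of a Gorenstein-projective module, in the stable category. -/
noncomputable def susp (X : StableGProj S) : StableGProj S := (stab S).obj (suspData X.as).W

/-- Distinguished triangles `X → Y → Z → ΣX` of the stable category: those isomorphic to the
triangle `X → E → F → ΣX` given by a short exact sequence `0 → X → E → F → 0` of
Gorenstein-projective modules. Its third morphism is `-z`, where `z` completes
a commutative diagram with exact rows from `0 → X → E → F → 0` to `0 → X → Q → ΣX → 0` that is
the identity on `X`. (As every morphism from `X` in the stable category is represented by an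
injective map `X → E` with Gorenstein-projective cokernel, isomorphisms of triangles that are the
identity on `X` suffice.) -/
def IsDistinguished {X Y Z : StableGProj S} (f : X ⟶ Y) (g : Y ⟶ Z) (h : Z ⟶ susp X) : Prop :=
  ∃ (E F : GProj S) (a : X.as ⟶ E) (b : E ⟶ F) (w : a.hom ≫ b.hom = 0)
    (_ : (ShortComplex.mk a.hom b.hom w).ShortExact)
    (y : E.obj ⟶ (suspData X.as).Q) (z : F ⟶ (suspData X.as).W)
    (_ : a.hom ≫ y = (suspData X.as).i) (_ : b.hom ≫ z.hom = y ≫ (suspData X.as).p)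
    (eY : (stab S).obj E ≅ Y) (eZ : (stab S).obj F ≅ Z),
    f = (stab S).map a ≫ eY.hom ∧ eY.hom ≫ g = (stab S).map b ≫ eZ.hom ∧
      eZ.hom ≫ h = -(stab S).map z

/-- Compact objects: `Hom(C, -)`, with values in abelian groups, commutes with small direct
sums. -/
def IsCompactObject (C : StableGProj S) : Prop :=
  ∀ J : Type u, PreservesColimitsOfShape (Discrete J) (preadditiveCoyoneda.obj (Opposite.op C))

/-- A triangle `X → Y → Z → ΣX` is pure if `0 → Hom(C, X) → Hom(C, Y) → Hom(C, Z) → 0` is exact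
for each compact object `C`. -/
def IsPureTriangle {X Y Z : StableGProj S} (f : X ⟶ Y) (g : Y ⟶ Z) : Prop :=
  ∀ C : StableGProj S, IsCompactObject C →
    Function.Injective (fun t : C ⟶ X => t ≫ f) ∧
    Function.Exact (fun t : C ⟶ X => t ≫ f) (fun t : C ⟶ Y => t ≫ g) ∧
    Function.Surjective (fun t : C ⟶ Y => t ≫ g)

/-- A triangle `X → Y → Z → ΣX` is split if it is isomorphic to the evident triangle
`X → X ⊕ Z → Z → ΣX` with third morphism zero. -/
def IsSplitTriangle {X Y Z : StableGProj S} (f : X ⟶ Y) (g : Y ⟶ Z) (h : Z ⟶ susp X) : Prop :=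
  (∃ (r : Y ⟶ X) (s : Z ⟶ Y), f ≫ r = 𝟙 X ∧ s ≫ g = 𝟙 Z ∧ r ≫ f + g ≫ s = 𝟙 Y) ∧ h = 0

/-- Pure-injective objects of the stable category: each pure triangle `X → Y → Z → ΣX`
splits. -/
def IsPureInjectiveObject (X : StableGProj S) : Prop :=
  ∀ (Y Z : StableGProj S) (f : X ⟶ Y) (g : Y ⟶ Z) (h : Z ⟶ susp X),
    IsDistinguished f g h → IsPureTriangle f g → IsSplitTriangle f g h

end Stable

end GorOrd

/-! Right `A`-modules are treated as modules over `Aᵐᵒᵖ`; write `W` for `Hom_R(A, ω)`.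

Part 1. A pure triangle on `M` comes from a short exact sequence `0 → M → E → F → 0` of
Gorenstein-projective modules. Finitely generated Gorenstein-projective modules are compact in the
stable category (`isCompactObject_of_finite`), so maps from them to `F` lift stably to `E`; since `E
→ F` is onto, stable lifts can be corrected to honest ones (`exists_lift_of_stab_lift`). Every map
from a finitely generated module to `F` factors through a finitely generated Gorenstein-projective
module (`exists_gorensteinProjective_factorization`), so `M → E` is pure in `Mod A`, hence splits,
and so does the triangle. The factorization gains depth one step at a time: maps `G → F` are
compared with maps from a cokernel of `G → A^m` to a cosyzygy of `F`, and passing to a syzygy raises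
the depth by one. At depth `dim R` the intermediate module is maximal CM.

Maximal CM modules are Gorenstein-projective (`GorensteinSetup.isGorensteinProjective`). They are
closed under kernels of free covers and, by duality into `ω`, under cokernels of suitable embeddings
into powers of the projective module `W`; splicing gives an acyclic complex. Its total acyclicity
needs maps to `A` to extend. Maps to `W` extend because `Ext¹_R(Z, ω) = 0` for maximal CM `Z`, so it
suffices that `A` is a summand of a power of `W`. Only projectivity of `W` is assumed; that `W` is a
generator follows from `End_A(W) = A` and a trace ideal argument (`Coind.traceIdeal_top`).

Part 2. A maximal CM module is finitely generated over `R`. Over complete `R` such modules are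
linearly compact (`exists_mem_of_directed_cosets`), hence pure-injective over any `R`-algebra acting
on them (`isPureInjectiveModule_of_complete`), and Part 1 applies. -/

namespace GorOrd

/-! ### Vanishing of Ext along short exact sequences. -/

section ExtVanishing

variable (R : Type u) [CommRing R]

/-- Vanishing of `Ext^i_R(X, Y)`. -/
def ExtVanishes (X Y : Type u) [AddCommGroup X] [Module R X] [AddCommGroup Y] [Module R Y]
    (i : ℕ) : Prop :=
  Subsingleton (Abelian.Ext (ModuleCat.of R X) (ModuleCat.of R Y) i)

variable {R} {X Y Z W X' Y' : Type u} [AddCommGroup X] [Module R X] [AddCommGroup Y] [Module R Y]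
  [AddCommGroup Z] [Module R Z] [AddCommGroup W] [Module R W]
  [AddCommGroup X'] [Module R X'] [AddCommGroup Y'] [Module R Y']

lemma extVanishes_congr (e : X ≃ₗ[R] X') (e' : Y ≃ₗ[R] Y') {i : ℕ} (h : ExtVanishes R X Y i) :
    ExtVanishes R X' Y' i := by
  have h' : Subsingleton (Abelian.Ext (ModuleCat.of R X) (ModuleCat.of R Y) i) := h
  obtain ⟨a⟩ : Nonempty (ModuleCat.of R X ≅ ModuleCat.of R X') := ⟨e.toModuleIso⟩
  obtain ⟨b⟩ : Nonempty (ModuleCat.of R Y ≅ ModuleCat.of R Y') := ⟨e'.toModuleIso⟩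
  refine subsingleton_of_forall_eq 0 fun x => ?_
  have h1 := Subsingleton.elim (((Abelian.Ext.mk₀ a.hom).comp x (zero_add i)).comp
        (Abelian.Ext.mk₀ b.inv) (add_zero i)) 0
  have h2 := congrArg (fun t => (Abelian.Ext.mk₀ a.inv).comp
    (t.comp (Abelian.Ext.mk₀ b.hom) (add_zero i)) (zero_add i)) h1
  simpa using h2

lemma ExtVanishes.zero_iff : ExtVanishes R X Y 0 ↔ Subsingleton (X →ₗ[R] Y) :=
  (Abelian.Ext.addEquiv₀.toEquiv.trans ModuleCat.homEquiv).subsingleton_congr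

lemma ExtVanishes.of_projective [Module.Projective R X] {i : ℕ} (hi : 0 < i) :
    ExtVanishes R X Y i := by
  obtain ⟨j, rfl⟩ := Nat.exists_eq_succ_of_ne_zero hi.ne'
  exact Abelian.Ext.subsingleton_of_projective _ _ _

lemma ExtVanishes.of_subsingleton_left [Subsingleton X] (i : ℕ) : ExtVanishes R X Y i := by
  cases i with
  | zero => exact zero_iff.2 ⟨fun f g => LinearMap.ext fun x => by
      rw [Subsingleton.elim x 0, map_zero, map_zero]⟩
  | succ i => exact of_projective (Nat.succ_pos i)

variable {f : X →ₗ[R] Y} {g : Y →ₗ[R] Z}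

lemma shortExact_of_linearMap (hf : Function.Injective f) (hg : Function.Surjective g)
    (h : Function.Exact f g) :
    (ShortComplex.mk (ModuleCat.ofHom f) (ModuleCat.ofHom g)
      (by rw [← ModuleCat.ofHom_comp, h.linearMap_comp_eq_zero]; rfl)).ShortExact where
  exact := by
    rw [ShortComplex.moduleCat_exact_iff]
    exact fun x hx => (h x).1 hx
  mono_f := (ModuleCat.mono_iff_injective _).2 hf
  epi_g := (ModuleCat.epi_iff_surjective _).2 hg

lemma ExtVanishes.covariant_left (hf : Function.Injective f) (hg : Function.Surjective g)
    (h : Function.Exact f g) {i : ℕ} (hZ : ∀ j, j + 1 = i → ExtVanishes R W Z j)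
    (hY : ExtVanishes R W Y i) : ExtVanishes R W X i := by
  have hY' : Subsingleton (Abelian.Ext (ModuleCat.of R W) (ModuleCat.of R Y) i) := hY
  cases i with
  | zero =>
    rw [zero_iff] at hY ⊢
    refine ⟨fun a b => LinearMap.ext fun x => hf ?_⟩
    exact LinearMap.congr_fun (Subsingleton.elim (f ∘ₗ a) (f ∘ₗ b)) x
  | succ i =>
    have hZ' : Subsingleton (Abelian.Ext (ModuleCat.of R W) (ModuleCat.of R Z) i) := hZ i rfl
    refine subsingleton_of_forall_eq 0 fun x => ?_
    obtain ⟨y, hy⟩ := Abelian.Ext.covariant_sequence_exact₁ (ModuleCat.of R W)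
      (shortExact_of_linearMap hf hg h) x (Subsingleton.elim _ _) rfl
    rw [← hy, Subsingleton.elim y 0, Abelian.Ext.zero_comp]

lemma ExtVanishes.covariant_middle (hf : Function.Injective f) (hg : Function.Surjective g)
    (h : Function.Exact f g) {i : ℕ} (hX : ExtVanishes R W X i) (hZ : ExtVanishes R W Z i) :
    ExtVanishes R W Y i := by
  have hX' : Subsingleton (Abelian.Ext (ModuleCat.of R W) (ModuleCat.of R X) i) := hX
  have hZ' : Subsingleton (Abelian.Ext (ModuleCat.of R W) (ModuleCat.of R Z) i) := hZ
  refine subsingleton_of_forall_eq 0 fun x => ?_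
  obtain ⟨y, hy⟩ := Abelian.Ext.covariant_sequence_exact₂ (ModuleCat.of R W)
    (shortExact_of_linearMap hf hg h) x (Subsingleton.elim _ _)
  rw [← hy, Subsingleton.elim y 0, Abelian.Ext.zero_comp]

lemma ExtVanishes.covariant_right (hf : Function.Injective f) (hg : Function.Surjective g)
    (h : Function.Exact f g) {i : ℕ} (hY : ExtVanishes R W Y i) (hX : ExtVanishes R W X (i + 1)) :
    ExtVanishes R W Z i := by
  have hX' : Subsingleton (Abelian.Ext (ModuleCat.of R W) (ModuleCat.of R X) (i + 1)) := hX
  have hY' : Subsingleton (Abelian.Ext (ModuleCat.of R W) (ModuleCat.of R Y) i) := hY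
  refine subsingleton_of_forall_eq 0 fun x => ?_
  obtain ⟨y, hy⟩ := Abelian.Ext.covariant_sequence_exact₃ (ModuleCat.of R W)
    (shortExact_of_linearMap hf hg h) x rfl (Subsingleton.elim _ _)
  rw [← hy, Subsingleton.elim y 0, Abelian.Ext.zero_comp]

lemma ExtVanishes.contravariant_left (hf : Function.Injective f) (hg : Function.Surjective g)
    (h : Function.Exact f g) {i : ℕ} (hY : ExtVanishes R Y W i) (hZ : ExtVanishes R Z W (i + 1)) :
    ExtVanishes R X W i := by
  have hY' : Subsingleton (Abelian.Ext (ModuleCat.of R Y) (ModuleCat.of R W) i) := hY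
  have hZ' : Subsingleton (Abelian.Ext (ModuleCat.of R Z) (ModuleCat.of R W) (i + 1)) := hZ
  refine subsingleton_of_forall_eq 0 fun x => ?_
  obtain ⟨y, hy⟩ := Abelian.Ext.contravariant_sequence_exact₁
    (shortExact_of_linearMap hf hg h) (ModuleCat.of R W) x (add_comm 1 i) (Subsingleton.elim _ _)
  rw [← hy, Subsingleton.elim y 0, Abelian.Ext.comp_zero]

lemma ExtVanishes.contravariant_middle (hf : Function.Injective f) (hg : Function.Surjective g)
    (h : Function.Exact f g) {i : ℕ} (hX : ExtVanishes R X W i) (hZ : ExtVanishes R Z W i) :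
    ExtVanishes R Y W i := by
  have hX' : Subsingleton (Abelian.Ext (ModuleCat.of R X) (ModuleCat.of R W) i) := hX
  have hZ' : Subsingleton (Abelian.Ext (ModuleCat.of R Z) (ModuleCat.of R W) i) := hZ
  refine subsingleton_of_forall_eq 0 fun x => ?_
  obtain ⟨y, hy⟩ := Abelian.Ext.contravariant_sequence_exact₂
    (shortExact_of_linearMap hf hg h) (ModuleCat.of R W) x (Subsingleton.elim _ _)
  rw [← hy, Subsingleton.elim y 0, Abelian.Ext.comp_zero]

lemma ExtVanishes.contravariant_right (hf : Function.Injective f) (hg : Function.Surjective g)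
    (h : Function.Exact f g) {i : ℕ} (hX : ExtVanishes R X W i) (hY : ExtVanishes R Y W (i + 1)) :
    ExtVanishes R Z W (i + 1) := by
  have hX' : Subsingleton (Abelian.Ext (ModuleCat.of R X) (ModuleCat.of R W) i) := hX
  have hY' : Subsingleton (Abelian.Ext (ModuleCat.of R Y) (ModuleCat.of R W) (i + 1)) := hY
  refine subsingleton_of_forall_eq 0 fun x => ?_
  obtain ⟨y, hy⟩ := Abelian.Ext.contravariant_sequence_exact₃
    (shortExact_of_linearMap hf hg h) (ModuleCat.of R W) x (Subsingleton.elim _ _) (add_comm 1 i)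
  rw [← hy, Subsingleton.elim y 0, Abelian.Ext.comp_zero]

/-- If `Ext¹(Z, W) = 0`, homomorphisms to `W` extend along monomorphisms with cokernel `Z`. -/
lemma ExtVanishes.exists_extension (hf : Function.Injective f) (hg : Function.Surjective g)
    (h : Function.Exact f g) (hZ : ExtVanishes R Z W 1) (a : X →ₗ[R] W) :
    ∃ b : Y →ₗ[R] W, b ∘ₗ f = a := by
  have hZ' : Subsingleton (Abelian.Ext (ModuleCat.of R Z) (ModuleCat.of R W) 1) := hZ
  obtain ⟨y, hy⟩ := Abelian.Ext.contravariant_sequence_exact₁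
    (shortExact_of_linearMap hf hg h) (ModuleCat.of R W)
    (Abelian.Ext.mk₀ (ModuleCat.ofHom a)) (add_zero 1) (Subsingleton.elim _ _)
  obtain ⟨b, rfl⟩ := (Abelian.Ext.mk₀_bijective _ _).2 y
  rw [Abelian.Ext.mk₀_comp_mk₀] at hy
  have := (Abelian.Ext.mk₀_bijective _ _).1 hy
  exact ⟨b.hom, congrArg ModuleCat.Hom.hom this⟩

lemma ExtVanishes.pi_right (n : ℕ) {i : ℕ} (h : ExtVanishes R W Y i) :
    ExtVanishes R W (Fin n → Y) i := by
  have h' : Subsingleton (Abelian.Ext (ModuleCat.of R W) (ModuleCat.of R Y) i) := h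
  refine subsingleton_of_forall_eq 0 fun x => ?_
  -- The identity of `Y^n` is a sum of maps through `Y`, so every class is a sum of images of
  -- classes that vanish.
  have hid : (𝟙 (ModuleCat.of R (Fin n → Y))) = ∑ j : Fin n,
      ModuleCat.ofHom (LinearMap.proj j) ≫ ModuleCat.ofHom (LinearMap.single R (fun _ => Y) j) := by
    ext v k
    simp [ModuleCat.hom_sum, Finset.sum_apply, Pi.single_apply]
  rw [← Abelian.Ext.comp_mk₀_id x, hid, Abelian.Ext.mk₀_sum, Abelian.Ext.comp_sum]
  refine Finset.sum_eq_zero fun j _ => ?_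
  rw [← Abelian.Ext.mk₀_comp_mk₀, ← Abelian.Ext.comp_assoc _ _ _ (add_zero i) (add_zero 0)
    (by simp), Subsingleton.elim (x.comp (Abelian.Ext.mk₀ _) (add_zero i)) 0,
    Abelian.Ext.zero_comp]

/-- Nakayama's lemma for `Ext`: if `x` acts surjectively on `Y` up to vanishing of the next
`Ext`-group and is in the maximal ideal, the `Ext`-group vanishes. -/
lemma ExtVanishes.of_quotSMulTop [IsLocalRing R] [IsNoetherianRing R] [Module.Finite R X]
    [Module.Finite R W] {x : R} (hx : x ∈ IsLocalRing.maximalIdeal R) (reg : IsSMulRegular X x)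
    {i : ℕ} (h : ExtVanishes R (QuotSMulTop x X) W (i + 1)) : ExtVanishes R X W i := by
  have hS := reg.smulShortComplex_shortExact (M := ModuleCat.of R X)
  have h' : Subsingleton (Abelian.Ext
    ((ModuleCat.of R X).smulShortComplex x).X₃ (ModuleCat.of R W) (i + 1)) := h
  -- The sequence `0 → X → X → X/xX → 0` makes multiplication by `x` surjective on the finitely
  -- generated module `Ext^i(X, W)`.
  have key : (⊤ : Submodule R (Abelian.Ext (ModuleCat.of R X) (ModuleCat.of R W) i)) ≤
      IsLocalRing.maximalIdeal R • ⊤ := by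
    rintro y -
    obtain ⟨z, hz'⟩ : ∃ z : Abelian.Ext (ModuleCat.of R X) (ModuleCat.of R W) i,
        (Abelian.Ext.mk₀ (x • 𝟙 (ModuleCat.of R X))).comp z (zero_add i) = y :=
      Abelian.Ext.contravariant_sequence_exact₁ hS (ModuleCat.of R W) y
        (add_comm 1 i) (Subsingleton.elim _ _)
    rw [Abelian.Ext.mk₀_smul, Abelian.Ext.smul_comp, Abelian.Ext.mk₀_id_comp] at hz'
    rw [← hz']
    exact Submodule.smul_mem_smul hx trivial
  have := Submodule.eq_bot_of_le_smul_of_le_jacobson_bot _ _ (Module.Finite.fg_top) key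
    (IsLocalRing.maximalIdeal_le_jacobson _)
  exact subsingleton_of_forall_eq 0 fun y => by
    have : y ∈ (⊥ : Submodule R (Abelian.Ext (ModuleCat.of R X) (ModuleCat.of R W) i)) :=
      this ▸ trivial
    simpa using this

end ExtVanishing

end GorOrd

/-! ### Depth. -/

namespace GorOrd

open scoped Pointwise in
lemma exact_lsmul_mkQ_quotSMulTop {R X : Type u} [CommRing R] [AddCommGroup X] [Module R X]
    (x : R) :
    Function.Exact (LinearMap.lsmul R X x) (x • (⊤ : Submodule R X)).mkQ :=
  LinearMap.exact_lsmul_mkQ_smul_top X x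

section Depth

variable (R : Type u) [CommRing R] [IsLocalRing R]

/-- `depth M ≥ n`: the groups `Ext^i(k, M)` vanish for `i < n`. -/
def DepthGE (n : ℕ) (M : Type u) [AddCommGroup M] [Module R M] : Prop :=
  ∀ i < n, ExtVanishes R (IsLocalRing.ResidueField R) M i

variable {R} {X Y Z : Type u} [AddCommGroup X] [Module R X] [AddCommGroup Y] [Module R Y]
  [AddCommGroup Z] [Module R Z]

lemma le_depth_iff (n : ℕ) : (n : ℕ∞) ≤ depth R (ModuleCat.of R X) ↔ DepthGE R n X := by
  simp only [depth, le_iInf_iff, DepthGE, ExtVanishes]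
  refine ⟨fun h i hi => ?_, fun h i hi => ?_⟩
  · by_contra hn
    exact absurd (Nat.cast_le.1 (h i (not_subsingleton_iff_nontrivial.1 hn))) (not_le.2 hi)
  · by_contra hn
    exact absurd (h i (Nat.cast_lt.1 (not_le.1 hn))) (not_subsingleton_iff_nontrivial.2 hi)

lemma isMaximalCM_iff {d : ℕ} (hd : ringKrullDim R = d) :
    IsMaximalCM R (ModuleCat.of R X) ↔ Module.Finite R X ∧ DepthGE R d X := by
  rw [← le_depth_iff]
  refine ⟨fun h => ⟨h.finite, ?_⟩, fun h => ⟨h.1, ?_⟩⟩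
  · have := h.dim_le_depth
    rw [hd] at this
    exact WithBot.coe_le_coe.1 this
  · rw [hd]
    exact WithBot.coe_le_coe.2 h.2

lemma exists_ringKrullDim_eq [IsNoetherianRing R] : ∃ d : ℕ, ringKrullDim R = d := by
  have h1 := ringKrullDim_ne_bot (R := R)
  have h2 := ringKrullDim_ne_top (R := R)
  generalize ringKrullDim R = t at h1 h2
  induction t using WithBot.recBotCoe with
  | bot => exact absurd rfl h1
  | coe t =>
    induction t using ENat.recTopCoe with
    | top => exact absurd rfl h2
    | coe n => exact ⟨n, rfl⟩

lemma DepthGE.mono {m n : ℕ} (hmn : m ≤ n) (h : DepthGE R n X) : DepthGE R m X :=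
  fun i hi => h i (hi.trans_le hmn)

lemma DepthGE.congr (e : X ≃ₗ[R] Y) {n : ℕ} (h : DepthGE R n X) : DepthGE R n Y :=
  fun i hi => extVanishes_congr (LinearEquiv.refl R _) e (h i hi)

lemma DepthGE.pi (m : ℕ) {n : ℕ} (h : DepthGE R n X) : DepthGE R n (Fin m → X) :=
  fun i hi => (h i hi).pi_right m

variable {f : X →ₗ[R] Y} {g : Y →ₗ[R] Z}

/-- The connecting map raises the degree by one, so a kernel may exceed the depth of the cokernel by
one. This is the mechanism by which syzygies gain depth. -/
lemma DepthGE.left (hf : Function.Injective f) (hg : Function.Surjective g)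
    (h : Function.Exact f g) {n : ℕ} (hY : DepthGE R (n + 1) Y) (hZ : DepthGE R n Z) :
    DepthGE R (n + 1) X :=
  fun i hi => ExtVanishes.covariant_left hf hg h (fun j hj => hZ j (by omega)) (hY i hi)

lemma DepthGE.left_of_le (hf : Function.Injective f) (hg : Function.Surjective g)
    (h : Function.Exact f g) {n : ℕ} (hY : DepthGE R n Y) (hZ : DepthGE R n Z) :
    DepthGE R n X :=
  fun i hi => ExtVanishes.covariant_left hf hg h (fun j hj => hZ j (by omega)) (hY i hi)

lemma DepthGE.middle (hf : Function.Injective f) (hg : Function.Surjective g)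
    (h : Function.Exact f g) {n : ℕ} (hX : DepthGE R n X) (hZ : DepthGE R n Z) :
    DepthGE R n Y :=
  fun i hi => ExtVanishes.covariant_middle hf hg h (hX i hi) (hZ i hi)

lemma DepthGE.quotSMulTop {x : R} (reg : IsSMulRegular X x) {n : ℕ} (h : DepthGE R (n + 1) X) :
    DepthGE R n (QuotSMulTop x X) :=
  fun i hi => ExtVanishes.covariant_right (f := LinearMap.lsmul R X x) reg
    (Submodule.mkQ_surjective _) (exact_lsmul_mkQ_quotSMulTop x) (h i (by omega))
    (h (i + 1) (by omega))

/-- Turns the vanishing of `Ext⁰(k, X)` into an element on which the inductions below can divide. -/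
lemma exists_regular_of_subsingleton [IsNoetherianRing R] [Module.Finite R X]
    (h : Subsingleton (IsLocalRing.ResidueField R →ₗ[R] X)) :
    ∃ x ∈ IsLocalRing.maximalIdeal R, IsSMulRegular X x := by
  obtain ⟨x, hx, hreg⟩ := IsSMulRegular.subsingleton_linearMap_iff.1 h
  refine ⟨x, ?_, hreg⟩
  have : Module.annihilator R (IsLocalRing.ResidueField R) = IsLocalRing.maximalIdeal R :=
    Ideal.annihilator_quotient
  rwa [this] at hx

end Depth

/-! ### Vanishing of Ext into a finitely generated module of finite injective dimension. -/

section Canonical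

variable {R : Type u} [CommRing R] [IsLocalRing R] [IsNoetherianRing R]
  {ω : Type u} [AddCommGroup ω] [Module R ω]

/-- A finitely generated module of depth zero which, as far as `Ext(-, ω)` is concerned, behaves
like one of projective dimension at most `dim R`. -/
lemma exists_depth_zero (ω : Type u) [AddCommGroup ω] [Module R ω] (e : ℕ) :
    ∀ (j : ℕ) (Q : Type u) [AddCommGroup Q] [Module R Q] [Module.Finite R Q] [Nontrivial Q],
      Module.supportDim R Q ≤ e → (∀ i > j, ExtVanishes R Q ω i) →
      ∃ (Q' : Type u) (_ : AddCommGroup Q') (_ : Module R Q'),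
        Module.Finite R Q' ∧ (∀ i > j + e, ExtVanishes R Q' ω i) ∧
        ¬ Subsingleton (IsLocalRing.ResidueField R →ₗ[R] Q') := by
  induction e with
  | zero =>
    intro j Q _ _ _ _ hdim hQ
    refine ⟨Q, _, _, inferInstance, hQ, fun hs => ?_⟩
    -- A regular `x` in the maximal ideal would leave a nonzero quotient of dimension one less,
    -- impossible when the dimension is at most zero.
    obtain ⟨x, hx, hreg⟩ := exists_regular_of_subsingleton hs
    have h1 := Module.supportDim_quotSMulTop_succ_eq_supportDim hreg hx
    have := nontrivial_quotSMulTop_of_mem_maximalIdeal Q hx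
    have h2 := Module.supportDim_ne_bot_of_nontrivial R (QuotSMulTop x Q)
    rw [← h1] at hdim
    generalize Module.supportDim R (QuotSMulTop x Q) = t at hdim h2
    induction t using WithBot.recBotCoe with
    | bot => exact h2 rfl
    | coe t =>
      have h3 : ((t + 1 : ℕ∞) : WithBot ℕ∞) ≤ ((0 : ℕ∞) : WithBot ℕ∞) := hdim
      rw [WithBot.coe_le_coe] at h3
      simp at h3
  | succ e ih =>
    intro j Q _ _ _ _ hdim hQ
    by_cases hs : Subsingleton (IsLocalRing.ResidueField R →ₗ[R] Q)
    · obtain ⟨x, hx, hreg⟩ := exists_regular_of_subsingleton hs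
      have h1 := Module.supportDim_quotSMulTop_succ_eq_supportDim hreg hx
      have := nontrivial_quotSMulTop_of_mem_maximalIdeal Q hx
      -- Dividing by `x` lowers the dimension by one and raises the bound for vanishing of `Ext(-,
      -- ω)` by one, so `j + e` is preserved.
      obtain ⟨Q', i1, i2, hf, h2, h3⟩ := ih (j + 1) (QuotSMulTop x Q) (by
        rw [← h1] at hdim
        generalize Module.supportDim R (QuotSMulTop x Q) = t at hdim
        induction t using WithBot.recBotCoe with
        | bot => exact bot_le
        | coe t =>
          have h3 : ((t + 1 : ℕ∞) : WithBot ℕ∞) ≤ ((e + 1 : ℕ∞) : WithBot ℕ∞) := hdim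
          rw [WithBot.coe_le_coe] at h3
          exact WithBot.coe_le_coe.2 ((ENat.add_le_add_iff_right ENat.one_ne_top).1 h3)) (by
        intro i hi
        obtain ⟨i, rfl⟩ := Nat.exists_eq_add_one_of_ne_zero (by omega : i ≠ 0)
        exact ExtVanishes.contravariant_right (f := LinearMap.lsmul R Q x) hreg
          (Submodule.mkQ_surjective _) (exact_lsmul_mkQ_quotSMulTop x) (hQ i (by omega))
          (hQ (i + 1) (by omega)))
      exact ⟨Q', i1, i2, hf, fun i hi => h2 i (by omega), h3⟩
    · exact ⟨Q, _, _, inferInstance, fun i hi => hQ i (by omega), hs⟩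

/-- Cutting `R` down by a maximal regular sequence gives `Q` with `Ext^i(Q, ω) = 0` for `i > d` into
which `k` embeds. Then `Ext^i(k, ω)` sits between `Ext^i(Q, ω)` and `Ext^{i+1}(Q/k, ω)`. -/
lemma extVanishes_residueField (d : ℕ) (hd : ringKrullDim R = d) {i : ℕ} (hi : d < i)
    (hω : ∀ (N : Type u) [AddCommGroup N] [Module R N] [Module.Finite R N],
      ExtVanishes R N ω (i + 1)) :
    ExtVanishes R (IsLocalRing.ResidueField R) ω i := by
  obtain ⟨Q, _, _, _, hQ, hs⟩ := exists_depth_zero ω d 0 R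
    (by rw [Module.supportDim_self_eq_ringKrullDim, hd])
    (fun i hi => ExtVanishes.of_projective hi)
  rw [not_subsingleton_iff_nontrivial] at hs
  obtain ⟨f, hf⟩ := exists_ne (0 : IsLocalRing.ResidueField R →ₗ[R] Q)
  have hinj : Function.Injective f := by
    have : IsSimpleModule R (IsLocalRing.ResidueField R) :=
      isSimpleModule_iff_isCoatom.2 (IsLocalRing.maximalIdeal.isMaximal R).out
    exact f.injective_or_eq_zero.resolve_right hf
  exact ExtVanishes.contravariant_left hinj (Submodule.mkQ_surjective (LinearMap.range f))
    (LinearMap.exact_map_mkQ_range f) (hQ i (by omega)) (hω _)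

/-- The injective dimension of `ω` is at most `dim R`. The induction on `m` descends in `i`,
starting beyond the known bound `n`. Prime filtrations reduce to `R/p`: the case of the residue
field is treated separately, and otherwise an element of the maximal ideal outside `p` is regular on
`R/p` and Nakayama applies. -/
lemma extVanishes_of_dim_lt [Module.Finite R ω] {n d : ℕ}
    (hω : HasInjectiveDimensionLT (ModuleCat.of R ω) n) (hd : ringKrullDim R = d) (m : ℕ) :
    ∀ i > d, n ≤ i + m → ∀ (N : Type u) [AddCommGroup N] [Module R N] [Module.Finite R N],
      ExtVanishes R N ω i := by
  induction m with
  | zero => exact fun i _ hni N _ _ _ => HasInjectiveDimensionLT.subsingleton _ n i (by omega) _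
  | succ m ih =>
    intro i hi hni N _ _ hN
    have ih' := ih (i + 1) (by omega) (by omega)
    refine IsNoetherianRing.induction_on_isQuotientEquivQuotientPrime R hN
      (motive := fun N _ _ _ => ExtVanishes R N ω i)
      (fun N _ _ _ _ => ExtVanishes.of_subsingleton_left i) (fun N _ _ _ p e => ?_)
      (fun N₁ _ _ _ N₂ _ _ _ N₃ _ _ _ f g hf hg hfg h₁ h₃ =>
        ExtVanishes.contravariant_middle hf hg hfg h₁ h₃)
    refine extVanishes_congr e.symm (LinearEquiv.refl R ω) ?_
    by_cases hp : p.1 = IsLocalRing.maximalIdeal R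
    · rw [hp]
      exact extVanishes_residueField d hd hi ih'
    · obtain ⟨y, hym, hyp⟩ := SetLike.exists_of_lt
        (lt_of_le_of_ne (IsLocalRing.le_maximalIdeal p.2.ne_top) hp)
      have hreg : IsSMulRegular (R ⧸ p.1) y := by
        have := p.2
        refine (isSMulRegular_iff_right_eq_zero_of_smul).2 fun z hz => ?_
        rw [Algebra.smul_def] at hz
        refine (mul_eq_zero.1 hz).resolve_left fun h0 => hyp ?_
        exact Ideal.Quotient.eq_zero_iff_mem.1 h0
      exact ExtVanishes.of_quotSMulTop hym hreg (ih' _)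

/-- Dividing `N` by a regular element trades one unit of depth for one degree of Ext, and Nakayama
for Ext carries the vanishing back. -/
lemma extVanishes_of_depthGE [Module.Finite R ω] {d : ℕ}
    (hω : ∃ n, HasInjectiveDimensionLT (ModuleCat.of R ω) n) (hd : ringKrullDim R = d) (j : ℕ) :
    ∀ (N : Type u) [AddCommGroup N] [Module R N] [Module.Finite R N], DepthGE R j N →
      ∀ i, d < i + j → ExtVanishes R N ω i := by
  obtain ⟨n, hn⟩ := hω
  induction j with
  | zero => exact fun N _ _ _ _ i hi => extVanishes_of_dim_lt hn hd n i hi (by omega) N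
  | succ j ih =>
    intro N _ _ _ hN i hi
    obtain ⟨x, hx, hreg⟩ := exists_regular_of_subsingleton
      (ExtVanishes.zero_iff.1 (hN 0 (Nat.succ_pos j)))
    exact ExtVanishes.of_quotSMulTop hx hreg (ih _ (hN.quotSMulTop hreg) (i + 1) (by omega))

end Canonical

end GorOrd

namespace GorOrd

/-! ### The functor `Hom_R(-, ω)` and biduality of free modules. -/

section Duality

variable {R : Type u} [CommRing R]
  {ω : Type u} [AddCommGroup ω] [Module R ω]
  {X Y Z : Type u} [AddCommGroup X] [Module R X] [AddCommGroup Y] [Module R Y]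
  [AddCommGroup Z] [Module R Z] {f : X →ₗ[R] Y} {g : Y →ₗ[R] Z}

lemma lcomp_injective (ω : Type u) [AddCommGroup ω] [Module R ω] (hg : Function.Surjective g) :
    Function.Injective (LinearMap.lcomp R ω g) := fun a b hab => by
  ext z
  obtain ⟨y, rfl⟩ := hg z
  exact LinearMap.congr_fun hab y

lemma lcomp_surjective (hf : Function.Injective f) (hg : Function.Surjective g)
    (h : Function.Exact f g) (hZ : ExtVanishes R Z ω 1) :
    Function.Surjective (LinearMap.lcomp R ω f) :=
  fun a => hZ.exists_extension hf hg h a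

lemma lcomp_exact (ω : Type u) [AddCommGroup ω] [Module R ω] (hg : Function.Surjective g)
    (h : Function.Exact f g) :
    Function.Exact (LinearMap.lcomp R ω g) (LinearMap.lcomp R ω f) := by
  intro a
  constructor
  · intro ha
    have hk : LinearMap.ker g ≤ LinearMap.ker a := by
      intro y hy
      obtain ⟨x, rfl⟩ := (h y).1 hy
      exact LinearMap.congr_fun ha x
    refine ⟨(Submodule.liftQ _ a hk) ∘ₗ (g.quotKerEquivOfSurjective hg).symm.toLinearMap, ?_⟩
    ext y
    have : (g.quotKerEquivOfSurjective hg).symm (g y) = Submodule.Quotient.mk y := by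
      rw [LinearEquiv.symm_apply_eq]
      rfl
    simp [this]
  · rintro ⟨b, rfl⟩
    ext x
    simp [h.apply_apply_eq_zero]

lemma finite_linearMap [IsNoetherianRing R] [Module.Finite R X] [Module.Finite R ω] :
    Module.Finite R (X →ₗ[R] ω) := by
  obtain ⟨n, f, hf⟩ := Module.Finite.exists_fin' R X
  have : Module.Finite R ((Fin n → R) →ₗ[R] ω) :=
    Module.Finite.equiv ((Pi.basisFun R (Fin n)).constr R)
  exact Module.Finite.of_injective _ (lcomp_injective ω hf)

/-- The evaluation map from `X` to its bidual with respect to `ω`. -/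
def bidual (R ω X : Type u) [CommRing R] [AddCommGroup ω] [Module R ω] [AddCommGroup X]
    [Module R X] : X →ₗ[R] (X →ₗ[R] ω) →ₗ[R] ω :=
  LinearMap.applyₗ

@[simp]
lemma bidual_apply (x : X) (a : X →ₗ[R] ω) : bidual R ω X x a = a x := rfl

lemma bidual_self_bijective (h : Function.Bijective (algebraMap R (Module.End R ω))) :
    Function.Bijective (bidual R ω R) := by
  constructor
  · intro x y hxy
    refine h.1 (LinearMap.ext fun w => ?_)
    have := LinearMap.congr_fun hxy (LinearMap.toSpanSingleton R ω w)
    simpa using this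
  · intro φ
    obtain ⟨r, hr⟩ := h.2 (φ ∘ₗ (LinearMap.ringLmapEquivSelf R R ω).symm.toLinearMap)
    refine ⟨r, LinearMap.ext fun a => ?_⟩
    have := LinearMap.congr_fun hr (a 1)
    simp only [Module.algebraMap_end_apply, LinearMap.comp_apply] at this
    rw [bidual_apply]
    calc a r = r • a 1 := by rw [← map_smul, smul_eq_mul, mul_one]
      _ = φ ((LinearMap.ringLmapEquivSelf R R ω).symm (a 1)) := this
      _ = φ a := by
        congr 1
        exact (LinearMap.ringLmapEquivSelf R R ω).symm_apply_apply a

lemma bidual_pi_bijective (h : Function.Bijective (algebraMap R (Module.End R ω))) (n : ℕ) :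
    Function.Bijective (bidual R ω (Fin n → R)) := by
  have h1 := bidual_self_bijective h
  constructor
  · intro x y hxy
    ext i
    refine h1.1 (LinearMap.ext fun a => ?_)
    exact LinearMap.congr_fun hxy (a ∘ₗ LinearMap.proj i)
  · intro φ
    choose r hr using fun i : Fin n => h1.2 (φ ∘ₗ LinearMap.lcomp R ω (LinearMap.proj i))
    refine ⟨r, LinearMap.ext fun a => ?_⟩
    have ha : a = ∑ i, (a ∘ₗ LinearMap.single R (fun _ => R) i) ∘ₗ LinearMap.proj i := by
      ext i
      simp [Pi.single_apply, apply_ite]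
    rw [ha, map_sum, map_sum]
    refine Finset.sum_congr rfl fun i _ => ?_
    have := LinearMap.congr_fun (hr i) (a ∘ₗ LinearMap.single R (fun _ => R) i)
    exact this

end Duality

/-! ### Duality of maximal CM modules. -/

section MaximalCM

variable {R : Type u} [CommRing R] [IsLocalRing R]
  {ω : Type u} [AddCommGroup ω] [Module R ω]
  {X Y Z : Type u} [AddCommGroup X] [Module R X] [AddCommGroup Y] [Module R Y]
  [AddCommGroup Z] [Module R Z]

lemma IsMaximalCM.congr (e : X ≃ₗ[R] Y) (h : IsMaximalCM R (ModuleCat.of R X)) :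
    IsMaximalCM R (ModuleCat.of R Y) where
  finite := by
    have : Module.Finite R X := h.finite
    exact Module.Finite.equiv e
  dim_le_depth := by
    refine h.dim_le_depth.trans (WithBot.coe_le_coe.2 ?_)
    refine ENat.forall_natCast_le_iff_le.1 fun n hn => ?_
    rw [le_depth_iff] at hn ⊢
    exact hn.congr e

lemma IsMaximalCM.of_linearEquiv {M N : ModuleCat.{u} R} (e : M ≃ₗ[R] N) (h : IsMaximalCM R M) :
    IsMaximalCM R N :=
  IsMaximalCM.congr (X := M) (Y := N) e h

variable [IsNoetherianRing R]

lemma IsMaximalCM.left {f : X →ₗ[R] Y} {g : Y →ₗ[R] Z} (hf : Function.Injective f)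
    (hg : Function.Surjective g) (hfg : Function.Exact f g)
    (hY : IsMaximalCM R (ModuleCat.of R Y)) (hZ : IsMaximalCM R (ModuleCat.of R Z)) :
    IsMaximalCM R (ModuleCat.of R X) := by
  obtain ⟨d, hd⟩ := exists_ringKrullDim_eq (R := R)
  rw [isMaximalCM_iff hd] at hY hZ ⊢
  obtain ⟨_, hY⟩ := hY
  exact ⟨Module.Finite.of_injective f hf, DepthGE.left_of_le hf hg hfg hY hZ.2⟩

lemma IsMaximalCM.ker {f : X →ₗ[R] Y} (hf : Function.Surjective f)
    (hX : IsMaximalCM R (ModuleCat.of R X)) (hY : IsMaximalCM R (ModuleCat.of R Y)) :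
    IsMaximalCM R (ModuleCat.of R (LinearMap.ker f)) := by
  exact IsMaximalCM.left (LinearMap.ker f).injective_subtype hf
    (LinearMap.exact_subtype_ker_map f) hX hY

lemma IsMaximalCM.pi (hX : IsMaximalCM R (ModuleCat.of R X)) (n : ℕ) :
    IsMaximalCM R (ModuleCat.of R (Fin n → X)) := by
  obtain ⟨d, hd⟩ := exists_ringKrullDim_eq (R := R)
  rw [isMaximalCM_iff hd] at hX ⊢
  obtain ⟨_, hX⟩ := hX
  exact ⟨inferInstance, hX.pi n⟩

variable (hR : IsCMLocalRing R) (hω : IsCanonicalModule R (ModuleCat.of R ω))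

include hω in
lemma IsMaximalCM.extVanishes (hX : IsMaximalCM R (ModuleCat.of R X)) {i : ℕ} (hi : 0 < i) :
    ExtVanishes R X ω i := by
  obtain ⟨d, hd⟩ := exists_ringKrullDim_eq (R := R)
  have : Module.Finite R ω := hω.finite
  have : Module.Finite R X := hX.finite
  exact extVanishes_of_depthGE hω.finite_injDim hd d X ((isMaximalCM_iff hd).1 hX).2 i (by omega)

include hR hω in
-- For a free cover `F → X` with kernel `K`, the sequence `0 → X* → F* → K* → 0` is exact because
-- `Ext¹(X, ω) = 0`. Since `F*` is a power of `ω` and `K` is again maximal CM, the depth of all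
-- duals grows by one at each step of the induction, until it reaches `d`.
lemma IsMaximalCM.dual (hX : IsMaximalCM R (ModuleCat.of R X)) :
    IsMaximalCM R (ModuleCat.of R (X →ₗ[R] ω)) := by
  obtain ⟨d, hd⟩ := exists_ringKrullDim_eq (R := R)
  have : Module.Finite R ω := hω.finite
  suffices H : ∀ j ≤ d, ∀ (X : Type u) [AddCommGroup X] [Module R X],
      IsMaximalCM R (ModuleCat.of R X) → DepthGE R j (X →ₗ[R] ω) by
    have : Module.Finite R X := hX.finite
    exact (isMaximalCM_iff hd).2 ⟨finite_linearMap, H d le_rfl X hX⟩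
  intro j
  induction j with
  | zero => exact fun _ X _ _ _ i hi => absurd hi (Nat.not_lt_zero i)
  | succ j ih =>
    intro hj X _ _ hX
    have : Module.Finite R X := hX.finite
    obtain ⟨n, f, hf⟩ := Module.Finite.exists_fin' R X
    have hK := IsMaximalCM.ker hf (hR.isSmallCM.toIsMaximalCM.pi n) hX
    have hF : DepthGE R d ((Fin n → R) →ₗ[R] ω) :=
      ((((isMaximalCM_iff hd).1 hω.toIsMaximalCM).2).pi n).congr
        ((Pi.basisFun R (Fin n)).constr R)
    exact DepthGE.left (lcomp_injective ω hf)
      (lcomp_surjective (LinearMap.ker f).injective_subtype hf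
        (LinearMap.exact_subtype_ker_map f) (hX.extVanishes hω one_pos))
      (lcomp_exact ω hf (LinearMap.exact_subtype_ker_map f)) (hF.mono hj)
      (ih (by omega) _ hK)

include hR hω in
lemma IsMaximalCM.bidual_bijective (hX : IsMaximalCM R (ModuleCat.of R X)) :
    Function.Bijective (bidual R ω X) := by
  have : Module.Finite R X := hX.finite
  obtain ⟨n, f, hf⟩ := Module.Finite.exists_fin' R X
  have hK := IsMaximalCM.ker hf (hR.isSmallCM.toIsMaximalCM.pi n) hX
  have hF := bidual_pi_bijective hω.homothety_bijective n
  have hex := LinearMap.exact_subtype_ker_map f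
  have hs := lcomp_surjective (LinearMap.ker f).injective_subtype hf hex
    (hX.extVanishes hω one_pos)
  -- Surjectivity is proved for all maximal CM modules first, as injectivity for `X` uses it for the
  -- syzygy. A functional on `Y*` extends to the dual of a free cover, because the dual of the
  -- syzygy has no `Ext¹` into `ω`; there it is evaluation at a point.
  have surj : ∀ (Y : Type u) [AddCommGroup Y] [Module R Y],
      IsMaximalCM R (ModuleCat.of R Y) → Function.Surjective (bidual R ω Y) := by
    intro Y _ _ hY φ
    have : Module.Finite R Y := hY.finite
    obtain ⟨m, g, hg⟩ := Module.Finite.exists_fin' R Y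
    have hL := IsMaximalCM.ker hg (hR.isSmallCM.toIsMaximalCM.pi m) hY
    have hex := LinearMap.exact_subtype_ker_map g
    obtain ⟨ψ, hψ⟩ := ((hL.dual hR hω).extVanishes hω one_pos).exists_extension
      (lcomp_injective ω hg) (lcomp_surjective (LinearMap.ker g).injective_subtype hg
        hex (hY.extVanishes hω one_pos)) (lcomp_exact ω hg hex) φ
    obtain ⟨x, rfl⟩ := (bidual_pi_bijective hω.homothety_bijective m).2 ψ
    exact ⟨g x, hψ⟩
  refine ⟨(injective_iff_map_eq_zero _).2 fun y hy => ?_, surj X hX⟩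
  obtain ⟨x, rfl⟩ := hf y
  have hexd := lcomp_exact ω hf hex
  -- If evaluation at `f x` vanishes, evaluation at `x` factors through the dual of the kernel,
  -- where it is evaluation at some `z` in the kernel; then `z = x`.
  obtain ⟨φ, hφ⟩ : ∃ φ : (LinearMap.ker f →ₗ[R] ω) →ₗ[R] ω,
      φ ∘ₗ LinearMap.lcomp R ω (LinearMap.ker f).subtype = bidual R ω _ x := by
    have := lcomp_exact ω hs hexd
    refine (this (bidual R ω _ x)).1 ?_
    ext a
    exact LinearMap.congr_fun hy a
  obtain ⟨z, rfl⟩ := surj _ hK φ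
  have hxz : (z : Fin n → R) = x := by
    refine hF.1 (LinearMap.ext fun b => ?_)
    exact LinearMap.congr_fun hφ b
  rw [← hxz]
  exact z.2

include hR hω in
/-- The cokernel of an injective map of maximal Cohen-Macaulay modules is maximal Cohen-Macaulay
when the dual map is surjective. -/
lemma IsMaximalCM.right {f : X →ₗ[R] Y} {g : Y →ₗ[R] Z} (hg : Function.Surjective g)
    (hfg : Function.Exact f g) (hf : Function.Surjective (LinearMap.lcomp R ω f))
    (hX : IsMaximalCM R (ModuleCat.of R X)) (hY : IsMaximalCM R (ModuleCat.of R Y)) :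
    IsMaximalCM R (ModuleCat.of R Z) := by
  have hX' := hX.dual hR hω
  have hK := (hY.dual hR hω).ker hf hX'
  have hex := LinearMap.exact_subtype_ker_map (LinearMap.lcomp R ω f)
  set K := LinearMap.ker (LinearMap.lcomp R ω f)
  -- The kernel `K` of `Y* → X*` is maximal CM, and `p` identifies `Z` with its dual.
  let p : Y →ₗ[R] (K →ₗ[R] ω) := LinearMap.lcomp R ω K.subtype ∘ₗ bidual R ω Y
  have hp : Function.Surjective p :=
    (lcomp_surjective K.injective_subtype hf hex (hX'.extVanishes hω one_pos)).comp
      (hY.bidual_bijective hR hω).2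
  have hker : LinearMap.ker p = LinearMap.ker g := by
    rw [hfg.linearMap_ker_eq]
    ext y
    constructor
    · intro hy
      obtain ⟨φ, hφ⟩ := (lcomp_exact ω hf hex (bidual R ω Y y)).1 hy
      obtain ⟨x, rfl⟩ := (hX.bidual_bijective hR hω).2 φ
      refine ⟨x, (hY.bidual_bijective hR hω).1 (LinearMap.ext fun a => ?_)⟩
      exact LinearMap.congr_fun hφ a
    · rintro ⟨x, rfl⟩
      rw [LinearMap.mem_ker]
      ext a
      exact LinearMap.congr_fun a.2 x
  exact (hK.dual hR hω).congr
    (((p.quotKerEquivOfSurjective hp).symm.trans (Submodule.quotEquivOfEq _ _ hker)).trans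
      (g.quotKerEquivOfSurjective hg))

end MaximalCM

end GorOrd

namespace GorOrd

/-! ### Artinian quotients modulo powers of the maximal ideal. -/

section Artinian

lemma isArtinianRing_quotient_pow (R : Type u) [CommRing R] [IsLocalRing R] [IsNoetherianRing R]
    (n : ℕ) : IsArtinianRing (R ⧸ IsLocalRing.maximalIdeal R ^ n) := by
  set m := IsLocalRing.maximalIdeal R
  cases subsingleton_or_nontrivial (R ⧸ m ^ n) with
  | inl h => infer_instance
  | inr h =>
    have hloc := IsLocalRing.of_surjective' (Ideal.Quotient.mk (m ^ n)) Ideal.Quotient.mk_surjective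
    refine (isArtinianRing_iff_isNilpotent_maximalIdeal _).2 ⟨n, ?_⟩
    have hle : IsLocalRing.maximalIdeal (R ⧸ m ^ n) ≤ m.map (Ideal.Quotient.mk (m ^ n)) := by
      intro x hx
      obtain ⟨r, rfl⟩ := Ideal.Quotient.mk_surjective x
      refine Ideal.mem_map_of_mem _ ((IsLocalRing.mem_maximalIdeal r).2 fun hr => ?_)
      exact (IsLocalRing.mem_maximalIdeal _).1 hx (hr.map _)
    have := Ideal.pow_right_mono hle n
    rw [← Ideal.map_pow, Ideal.map_quotient_self] at this
    exact le_bot_iff.1 this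

lemma isArtinian_quotient_pow {R : Type u} [CommRing R] [IsLocalRing R] [IsNoetherianRing R]
    (M : Type u) [AddCommGroup M] [Module R M] [Module.Finite R M] (n : ℕ) :
    IsArtinian R (M ⧸ (IsLocalRing.maximalIdeal R ^ n • ⊤ : Submodule R M)) := by
  have := isArtinianRing_quotient_pow R n
  have : Module.Finite (R ⧸ IsLocalRing.maximalIdeal R ^ n)
      (M ⧸ (IsLocalRing.maximalIdeal R ^ n • ⊤ : Submodule R M)) :=
    Module.Finite.of_restrictScalars_finite R _ _
  have : IsArtinian (R ⧸ IsLocalRing.maximalIdeal R ^ n)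
      (M ⧸ (IsLocalRing.maximalIdeal R ^ n • ⊤ : Submodule R M)) :=
    inferInstance
  exact isArtinian_of_surjective_algebraMap (R := R ⧸ IsLocalRing.maximalIdeal R ^ n)
    Ideal.Quotient.mk_surjective

end Artinian

/-! ### The coinduced module `W = Hom_R(A, ω)` and its trace ideal. -/

open MulOpposite

/-- The right `A`-module `Hom_R(A, ω)`. -/
def Coind (R A ω : Type u) [CommRing R] [Ring A] [Algebra R A] [AddCommGroup ω] [Module R ω] :
    Type u :=
  A →ₗ[R] ω

namespace Coind

variable {R A ω : Type u} [CommRing R] [Ring A] [Algebra R A] [AddCommGroup ω] [Module R ω]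

instance : AddCommGroup (Coind R A ω) := inferInstanceAs (AddCommGroup (A →ₗ[R] ω))
instance : Module R (Coind R A ω) := inferInstanceAs (Module R (A →ₗ[R] ω))
instance : Module Aᵐᵒᵖ (Coind R A ω) := inferInstanceAs (Module Aᵈᵐᵃ (A →ₗ[R] ω))
instance : FunLike (Coind R A ω) A ω := inferInstanceAs (FunLike (A →ₗ[R] ω) A ω)
instance : LinearMapClass (Coind R A ω) R A ω :=
  inferInstanceAs (LinearMapClass (A →ₗ[R] ω) R A ω)

@[ext]
lemma ext {f g : Coind R A ω} (h : ∀ x, f x = g x) : f = g := DFunLike.ext _ _ h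

@[simp] lemma add_apply (f g : Coind R A ω) (x : A) : (f + g) x = f x + g x := rfl
@[simp] lemma smul_apply (r : R) (f : Coind R A ω) (x : A) : (r • f) x = r • f x := rfl
@[simp] lemma op_smul_apply (a : Aᵐᵒᵖ) (f : Coind R A ω) (x : A) :
    (a • f) x = f (unop a * x) := rfl

instance : IsScalarTower R Aᵐᵒᵖ (Coind R A ω) where
  smul_assoc r a f := by ext x; simp

section Lift

variable {X : Type u} [AddCommGroup X] [Module R X] [Module Aᵐᵒᵖ X] [IsScalarTower R Aᵐᵒᵖ X]

/-- The `A`-linear map to the coinduced module induced by an `R`-linear map to `ω`. -/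
def lift (g : X →ₗ[R] ω) : X →ₗ[Aᵐᵒᵖ] Coind R A ω where
  toFun x := (({ toFun := fun a => g (op a • x)
                 map_add' := fun a b => by rw [MulOpposite.op_add, add_smul, map_add]
                 map_smul' := fun r a => by
                  rw [op_smul, smul_assoc, map_smul, RingHom.id_apply] } : A →ₗ[R] ω))
  map_add' x y := by
    ext a
    change g _ = g _ + g _
    rw [smul_add, map_add]
  map_smul' c x := by
    ext a
    change g _ = g _
    rw [smul_smul]
    rfl

@[simp] lemma lift_apply (g : X →ₗ[R] ω) (x : X) (a : A) : lift g x a = g (op a • x) := rfl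

/-- Evaluation at `1`. -/
def ev : Coind R A ω →ₗ[R] ω where
  toFun f := f 1
  map_add' _ _ := rfl
  map_smul' _ _ := rfl

@[simp] lemma ev_apply (f : Coind R A ω) : ev f = f 1 := rfl

end Lift

lemma apply_eq_ev (f : Coind R A ω) (a : A) : f a = ev (op a • f) := by simp

/-- Together with `lift` this is the adjunction between restriction to `R` and coinduction. -/
lemma hom_ext {X : Type u} [AddCommGroup X] [Module Aᵐᵒᵖ X]
    {f g : X →ₗ[Aᵐᵒᵖ] Coind R A ω} (h : ∀ x, ev (f x) = ev (g x)) : f = g := by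
  ext x a
  rw [apply_eq_ev, apply_eq_ev, ← map_smul, ← map_smul, h]

/-- The left action of `A` on the coinduced module: `(b · f) x = f (x * b)`. -/
def rho (b : A) : Coind R A ω →ₗ[Aᵐᵒᵖ] Coind R A ω where
  toFun f := ((f : A →ₗ[R] ω) ∘ₗ LinearMap.mulRight R b : A →ₗ[R] ω)
  map_add' _ _ := rfl
  map_smul' c f := by
    ext x
    change f (unop c * (x * b)) = f (unop c * x * b)
    rw [mul_assoc]

@[simp] lemma rho_apply (b : A) (f : Coind R A ω) (x : A) : rho b f x = f (x * b) := rfl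

lemma rho_rho (b c : A) (f : Coind R A ω) : rho b (rho c f) = rho (b * c) f := by
  ext x; simp [mul_assoc]

lemma rho_add (b c : A) (f : Coind R A ω) : rho (b + c) f = rho b f + rho c f := by
  ext x; simp [mul_add]

lemma rho_smul (r : R) (c : A) (f : Coind R A ω) : rho (r • c) f = r • rho c f := by
  ext x; simp

lemma rho_injective (h : Function.Bijective (bidual R ω A)) {a b : A}
    (hab : ∀ f : Coind R A ω, rho a f = rho b f) : a = b := by
  refine h.1 (LinearMap.ext fun f => ?_)
  have : f (1 * a) = f (1 * b) := congrArg ev (hab f)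
  rwa [one_mul, one_mul] at this

/-- An endomorphism is determined by its composite with evaluation at `1`, a functional on `Hom_R(A,
ω)`; biduality makes it evaluation at some `b`. With `rho_injective` this gives `End_A(W) = A`. -/
lemma rho_surjective (h : Function.Bijective (bidual R ω A))
    (F : Coind R A ω →ₗ[Aᵐᵒᵖ] Coind R A ω) : ∃ b, F = rho b := by
  obtain ⟨b, hb⟩ := h.2 ((ev ∘ₗ F.restrictScalars R : Coind R A ω →ₗ[R] ω))
  refine ⟨b, hom_ext fun f => ?_⟩
  have h1 : f b = F f 1 := LinearMap.congr_fun hb f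
  rw [ev_apply, ev_apply, rho_apply, one_mul, h1]

/-- The submodule `K · Hom_R(A, ω)`. -/
def leftMul (ω : Type u) [AddCommGroup ω] [Module R ω] (K : Submodule R A) :
    Submodule R (Coind R A ω) :=
  Submodule.span R {w | ∃ k ∈ K, ∃ f, w = rho k f}

/-- The submodule `Hom_R(A, ω) · K`. -/
def rightMul (ω : Type u) [AddCommGroup ω] [Module R ω] (K : Submodule R A) :
    Submodule R (Coind R A ω) :=
  Submodule.span R {w | ∃ k ∈ K, ∃ f : Coind R A ω, w = op k • f}

/-- The ideal generated by the values on `K · Hom_R(A, ω)` of `A`-linear maps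
`Hom_R(A, ω) → A`. -/
def traceIdeal (ω : Type u) [AddCommGroup ω] [Module R ω] (K : Submodule R A) :
    Submodule R A :=
  Submodule.span R {a | ∃ k ∈ K, ∃ (f : Coind R A ω) (φ : Coind R A ω →ₗ[Aᵐᵒᵖ] Aᵐᵒᵖ),
    a = unop (φ (rho k f))}

lemma leftMul_mono {K L : Submodule R A} (h : K ≤ L) : leftMul ω K ≤ leftMul ω L :=
  Submodule.span_mono fun _ ⟨k, hk, f, hf⟩ => ⟨k, h hk, f, hf⟩

lemma traceIdeal_mono {K L : Submodule R A} (h : K ≤ L) : traceIdeal ω K ≤ traceIdeal ω L :=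
  Submodule.span_mono fun _ ⟨k, hk, f, hf⟩ => ⟨k, h hk, f, hf⟩

lemma mul_mem_traceIdeal (K : Submodule R A) (a : A) {t : A} (ht : t ∈ traceIdeal ω K) :
    a * t ∈ traceIdeal ω K := by
  induction ht using Submodule.span_induction with
  | mem x hx =>
    obtain ⟨k, hk, f, φ, rfl⟩ := hx
    exact Submodule.subset_span ⟨k, hk, f, LinearMap.toSpanSingleton Aᵐᵒᵖ Aᵐᵒᵖ (op a) ∘ₗ φ, by simp⟩
  | zero => simp
  | add x y _ _ hx hy => rw [mul_add]; exact add_mem hx hy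
  | smul r x _ hx => rw [mul_smul_comm]; exact Submodule.smul_mem _ r hx

lemma traceIdeal_mul_mem (K : Submodule R A) (a : A) {t : A} (ht : t ∈ traceIdeal ω K) :
    t * a ∈ traceIdeal ω K := by
  induction ht using Submodule.span_induction with
  | mem x hx =>
    obtain ⟨k, hk, f, φ, rfl⟩ := hx
    exact Submodule.subset_span ⟨k, hk, op a • f, φ, by simp⟩
  | zero => simp
  | add x y _ _ hx hy => rw [add_mul]; exact add_mem hx hy
  | smul r x _ hx => rw [smul_mul_assoc]; exact Submodule.smul_mem _ r hx

lemma exists_dual_basis {S W : Type u} [Ring S] [AddCommGroup W] [Module S W]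
    [Module.Finite S W] [Module.Projective S W] :
    ∃ (n : ℕ) (φ : Fin n → W →ₗ[S] S) (e : Fin n → W), ∀ w, w = ∑ i, φ i w • e i := by
  obtain ⟨n, p, hp⟩ := Module.Finite.exists_fin' S W
  obtain ⟨s, hs⟩ := Module.projective_lifting_property p LinearMap.id hp
  refine ⟨n, fun i => LinearMap.proj i ∘ₗ s, fun i => p (Pi.single i 1), fun w => ?_⟩
  conv_lhs => rw [← LinearMap.id_apply (R := S) w, ← hs, LinearMap.comp_apply,
    pi_eq_sum_univ' (s w)]
  simp

/-- For `φ : W → A` the map `x ↦ w · φ(x)` is an endomorphism of `W`, hence left multiplication by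
some `b`; so `w · φ(k f) = (b k) f`. Conversely a dual basis expands `k f` in terms of its values
under maps `W → A`. -/
lemma rightMul_traceIdeal (h : Function.Bijective (bidual R ω A))
    [Module.Finite Aᵐᵒᵖ (Coind R A ω)] [Module.Projective Aᵐᵒᵖ (Coind R A ω)]
    {K : Submodule R A} (hK : ∀ (a : A), ∀ k ∈ K, a * k ∈ K) :
    rightMul ω (traceIdeal ω K) = leftMul ω K := by
  refine le_antisymm (Submodule.span_le.2 ?_) (Submodule.span_le.2 ?_)
  · rintro _ ⟨t, ht, w, rfl⟩
    rw [SetLike.mem_coe]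
    induction ht using Submodule.span_induction with
    | mem x hx =>
      obtain ⟨k, hk, f, φ, rfl⟩ := hx
      obtain ⟨b, hb⟩ := rho_surjective h (LinearMap.toSpanSingleton Aᵐᵒᵖ _ w ∘ₗ φ)
      have := LinearMap.congr_fun hb (rho k f)
      rw [rho_rho] at this
      exact Submodule.subset_span ⟨b * k, hK b k hk, f, this⟩
    | zero => simp
    | add x y _ _ hx hy => rw [MulOpposite.op_add, add_smul]; exact add_mem hx hy
    | smul r x _ hx => rw [op_smul, smul_assoc]; exact Submodule.smul_mem _ r hx
  · rintro _ ⟨k, hk, f, rfl⟩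
    obtain ⟨n, φ, e, he⟩ := exists_dual_basis (S := Aᵐᵒᵖ) (W := Coind R A ω)
    rw [SetLike.mem_coe, he (rho k f)]
    exact sum_mem fun i _ => Submodule.subset_span
      ⟨unop (φ i (rho k f)), Submodule.subset_span ⟨k, hk, f, φ i, rfl⟩, e i, rfl⟩

/-- A right ideal `K` can be recovered from `K W`. Generators `c_j` of `K` map `W^m` onto `K W`;
projectivity lifts `k : W → K W` to `W^m`, and the components of the lift are elements `b_j` of
`End_A(W) = A`, so `k = ∑ c_j b_j`. -/
lemma mem_of_rho_mem [IsNoetherian R A] (h : Function.Bijective (bidual R ω A))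
    [Module.Projective Aᵐᵒᵖ (Coind R A ω)]
    {K : Submodule R A} (hK : ∀ (a : A), ∀ k ∈ K, k * a ∈ K) {k : A}
    (hk : ∀ f, rho k f ∈ leftMul ω K) : k ∈ K := by
  obtain ⟨m, c, hc⟩ := Submodule.fg_iff_exists_fin_generating_family.1
    (IsNoetherian.noetherian K)
  let p : (Fin m → Coind R A ω) →ₗ[Aᵐᵒᵖ] Coind R A ω :=
    ∑ j, rho (c j) ∘ₗ LinearMap.proj j
  have hp (v) : p v = ∑ j, rho (c j) (v j) := by simp [p]
  have hcK (j) : c j ∈ K := hc ▸ Submodule.subset_span ⟨j, rfl⟩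
  have hmem (w) (hw : w ∈ leftMul ω K) : w ∈ LinearMap.range p := by
    induction hw using Submodule.span_induction with
    | mem x hx =>
      obtain ⟨k, hk, f, rfl⟩ := hx
      rw [← hc] at hk
      induction hk using Submodule.span_induction with
      | mem x hx =>
        obtain ⟨j, rfl⟩ := hx
        exact ⟨Pi.single j f, by simp [hp, Pi.single_apply, apply_ite]⟩
      | zero => exact ⟨0, by ext x; simp [show rho (0 : A) f = 0 from by ext x; simp [show (0 : Coind R A ω) x = 0 from rfl]]⟩
      | add x y _ _ hx hy => rw [rho_add]; exact add_mem hx hy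
      | smul r x _ hx =>
        rw [rho_smul, ← algebraMap_smul Aᵐᵒᵖ]
        exact Submodule.smul_mem _ _ hx
    | zero => simp
    | add x y _ _ hx hy => exact add_mem hx hy
    | smul r x _ hx =>
      rw [← algebraMap_smul Aᵐᵒᵖ]
      exact Submodule.smul_mem _ _ hx
  obtain ⟨g, hg⟩ := Module.projective_lifting_property p.rangeRestrict
    ((rho k).codRestrict (LinearMap.range p) fun f => hmem _ (hk f)) p.surjective_rangeRestrict
  choose b hb using fun j : Fin m => rho_surjective h (LinearMap.proj j ∘ₗ g)
  have key : k = ∑ j, c j * b j := by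
    refine rho_injective h fun f => ?_
    have h1 := congrArg Subtype.val (LinearMap.congr_fun hg f)
    have h2 : p (g f) = rho k f := h1
    rw [← h2, hp]
    have h3 (j) : g f j = rho (b j) f := LinearMap.congr_fun (hb j) f
    simp only [h3, rho_rho]
    ext x
    have : (∑ j, rho (c j * b j) f) x = ∑ j, rho (c j * b j) f x :=
      map_sum (LinearMap.applyₗ x : (A →ₗ[R] ω) →ₗ[R] ω) (fun j => rho (c j * b j) f) _
    rw [this]
    simp [Finset.mul_sum]
  rw [key]
  exact sum_mem fun j _ => hK _ _ (hcK j)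

/-- Scalars from `R` are central, so `I A` can be moved from the right of `W` to the left. -/
lemma rightMul_le_leftMul {K L : Submodule R A} (I : Ideal R)
    (h : rightMul ω L ≤ leftMul ω K) :
    rightMul ω (L ⊔ I • ⊤) ≤ leftMul ω (K ⊔ I • ⊤) := by
  refine Submodule.span_le.2 ?_
  rintro _ ⟨t, ht, w, rfl⟩
  obtain ⟨a, ha, b, hb, rfl⟩ := Submodule.mem_sup.1 ht
  rw [MulOpposite.op_add, add_smul, SetLike.mem_coe]
  refine add_mem (leftMul_mono le_sup_left (h (Submodule.subset_span ⟨a, ha, w, rfl⟩)))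
    (leftMul_mono le_sup_right ?_)
  clear ht
  induction hb using Submodule.smul_induction_on' with
  | smul r hr n _ =>
    refine Submodule.subset_span ⟨r • 1, Submodule.smul_mem_smul hr trivial, op n • w, ?_⟩
    ext x
    simp
  | add x _ y _ hx hy => rw [MulOpposite.op_add, add_smul]; exact add_mem hx hy

section Local

variable [IsLocalRing R] [IsNoetherianRing R] [Module.Finite R A]

/-- The trace ideal of `Hom_R(A, ω)` is `A` when `Hom_R(A, ω)` is projective. -/
lemma traceIdeal_top (h : Function.Bijective (bidual R ω A))
    [Module.Finite Aᵐᵒᵖ (Coind R A ω)] [Module.Projective Aᵐᵒᵖ (Coind R A ω)] :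
    traceIdeal ω (⊤ : Submodule R A) = ⊤ := by
  let m : Submodule R A := IsLocalRing.maximalIdeal R • ⊤
  -- The iterates form a descending chain of two-sided ideals with `W T_{n+1} = T_n W`.
  let T : ℕ → Submodule R A := fun n => (traceIdeal ω)^[n] ⊤
  have hT (n) : T (n + 1) = traceIdeal ω (T n) := Function.iterate_succ_apply' _ _ _
  have hTl (n) (a : A) : ∀ k ∈ T n, a * k ∈ T n := by
    cases n with
    | zero => exact fun _ _ => trivial
    | succ n => rw [hT]; exact fun k hk => mul_mem_traceIdeal _ a hk
  have hTr (n) (a : A) : ∀ k ∈ T n, k * a ∈ T n := by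
    cases n with
    | zero => exact fun _ _ => trivial
    | succ n => rw [hT]; exact fun k hk => traceIdeal_mul_mem _ a hk
  have hmr (a : A) : ∀ k ∈ m, k * a ∈ m := by
    intro k hk
    induction hk using Submodule.smul_induction_on' with
    | smul r hr n _ => rw [smul_mul_assoc]; exact Submodule.smul_mem_smul hr trivial
    | add x _ y _ hx hy => rw [add_mul]; exact add_mem hx hy
  have hdesc (n) : T (n + 1) ≤ T n := by
    induction n with
    | zero => exact le_top
    | succ n ih => rw [hT (n + 1), hT n]; exact traceIdeal_mono (hT n ▸ ih)
  -- Stability modulo the maximal ideal propagates down the chain: `T_n W = W T_{n+1} ⊆ W (T_{n+2} +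
  -- m) ⊆ (T_{n+1} + m) W`, and `mem_of_rho_mem` removes `W`. The chain is stable somewhere since
  -- `A/m` is artinian, so `T_0 = A` gives `A = T_1 + m` and Nakayama finishes.
  have hstep (n) (hn : T (n + 1) ≤ T (n + 2) ⊔ m) : T n ≤ T (n + 1) ⊔ m := by
    intro k hk
    refine mem_of_rho_mem (ω := ω) h (fun a k hk => ?_) fun f => ?_
    · obtain ⟨x, hx, y, hy, rfl⟩ := Submodule.mem_sup.1 hk
      rw [add_mul]
      exact Submodule.add_mem_sup (hTr _ a x hx) (hmr a y hy)
    · have h1 : rho k f ∈ rightMul ω (T (n + 1)) := by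
        rw [hT, rightMul_traceIdeal h (hTl n)]
        exact Submodule.subset_span ⟨k, hk, f, rfl⟩
      have h2 : rightMul ω (T (n + 1)) ≤ rightMul ω (T (n + 2) ⊔ m) :=
        Submodule.span_mono fun _ ⟨k, hk, f, hf⟩ => ⟨k, hn hk, f, hf⟩
      refine rightMul_le_leftMul _ (le_of_eq ?_) (h2 h1)
      rw [hT (n + 1), rightMul_traceIdeal h (hTl (n + 1))]
  have hstab : ∃ n, T n ≤ T (n + 1) ⊔ m := by
    have : IsArtinian R (A ⧸ m) := by
      have := isArtinian_quotient_pow (R := R) A 1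
      rwa [pow_one] at this
    obtain ⟨n, hn⟩ := IsArtinian.monotone_stabilizes (R := R) (M := A ⧸ m)
      ⟨fun n => OrderDual.toDual ((T n).map m.mkQ), fun a b hab =>
        Submodule.map_mono (antitone_nat_of_succ_le hdesc hab)⟩
    refine ⟨n, ?_⟩
    have h1 : (T n).map m.mkQ = (T (n + 1)).map m.mkQ := hn (n + 1) (Nat.le_succ n)
    have h2 := congrArg (Submodule.comap m.mkQ) h1
    rw [Submodule.comap_map_mkQ, Submodule.comap_map_mkQ] at h2
    rw [sup_comm, ← h2]
    exact le_sup_right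
  obtain ⟨n, hn⟩ := hstab
  have h0 : T 0 ≤ T 1 ⊔ m := by
    induction n with
    | zero => exact hn
    | succ n ih => exact ih (hstep n hn)
  exact top_le_iff.1 (Submodule.le_of_le_smul_of_le_jacobson_bot Module.Finite.fg_top
    (IsLocalRing.maximalIdeal_le_jacobson ⊥) h0)

/-- If `Hom_R(A, ω)` is projective, then `A` is a direct summand of a power of it. -/
lemma exists_retract (h : Function.Bijective (bidual R ω A))
    [Module.Finite Aᵐᵒᵖ (Coind R A ω)] [Module.Projective Aᵐᵒᵖ (Coind R A ω)] :
    ∃ (n : ℕ) (i : Aᵐᵒᵖ →ₗ[Aᵐᵒᵖ] (Fin n → Coind R A ω)) (p : (Fin n → Coind R A ω) →ₗ[Aᵐᵒᵖ] Aᵐᵒᵖ),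
      p ∘ₗ i = LinearMap.id := by
  have h1 : (1 : A) ∈ traceIdeal ω (⊤ : Submodule R A) := by rw [traceIdeal_top h]; trivial
  -- An expression `1 = ∑ r_i φ_i(k_i f_i)` is the retraction: send `1` to `(k_i f_i)` and come back
  -- by `∑ r_i φ_i`.
  obtain ⟨n, r, g, hg⟩ := Submodule.mem_span_set'.1 h1
  choose k _ f φ hφ using fun i => (g i).2
  refine ⟨n, LinearMap.toSpanSingleton _ _ fun i => rho (k i) (f i),
    ∑ i, LinearMap.toSpanSingleton Aᵐᵒᵖ Aᵐᵒᵖ (op (algebraMap R A (r i))) ∘ₗ φ i ∘ₗ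
      LinearMap.proj i, ?_⟩
  ext
  apply unop_injective
  simp [← hφ, ← Algebra.smul_def, hg]

end Local

end Coind

end GorOrd

namespace GorOrd

/-! ### Extending homomorphisms to projective modules. -/

section Extension

variable {S : Type u} [Ring S] {X Y Q : Type u} [AddCommGroup X] [Module S X]
  [AddCommGroup Y] [Module S Y] [AddCommGroup Q] [Module S Q]

/-- If homomorphisms from a finitely generated module `X` to the ring extend along `j`, so do
homomorphisms to arbitrary projective modules. -/
lemma exists_extension_of_projective [Module.Finite S X] [Module.Projective S Q]
    (j : X →ₗ[S] Y) (hj : ∀ a : X →ₗ[S] S, ∃ b : Y →ₗ[S] S, b ∘ₗ j = a) (f : X →ₗ[S] Q) :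
    ∃ g : Y →ₗ[S] Q, g ∘ₗ j = f := by
  classical
  obtain ⟨s, hs⟩ := Module.projective_def'.1 (inferInstance : Module.Projective S Q)
  obtain ⟨t, ht⟩ := Module.Finite.fg_top (R := S) (M := X)
  choose b hb using fun q : Q => hj (Finsupp.lapply q ∘ₗ s ∘ₗ f)
  -- Finite generation of `X` means only finitely many coordinates of `s ∘ f` are nonzero, so their
  -- extensions can be summed.
  let supp : Finset Q := t.biUnion fun x => (s (f x)).support
  have hsupp (x : X) (q : Q) (hq : q ∉ supp) : s (f x) q = 0 := by
    have hx : x ∈ Submodule.span S (t : Set X) := ht ▸ trivial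
    induction hx using Submodule.span_induction with
    | mem x hx =>
      by_contra h
      exact hq (Finset.mem_biUnion.2 ⟨x, hx, Finsupp.mem_support_iff.2 h⟩)
    | zero => simp
    | add x y _ _ hx hy => simp [hx, hy]
    | smul r x _ hx => simp [hx]
  refine ⟨∑ q ∈ supp, LinearMap.toSpanSingleton S Q q ∘ₗ b q, LinearMap.ext fun x => ?_⟩
  have h1 : f x = Finsupp.linearCombination S id (s (f x)) := (LinearMap.congr_fun hs (f x)).symm
  have h2 (q : Q) : b q (j x) = s (f x) q := LinearMap.congr_fun (hb q) x
  rw [h1, Finsupp.linearCombination_apply, Finsupp.sum_of_support_subset (s := supp)]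
  · simp [h2]
  · intro q hq
    by_contra h
    exact (Finsupp.mem_support_iff.1 hq) (hsupp x q h)
  · simp

end Extension

/-! ### Splicing short exact sequences into totally acyclic complexes. -/

section Gluing

variable {S : Type u} [Ring S]

/-- A short exact sequence `0 → M → P → N → 0` with `P` projective such that homomorphisms from
`M` to projective modules extend to `P`. -/
structure ProjStep (M N : ModuleCat.{u} S) where
  P : ModuleCat.{u} S
  i : M ⟶ P
  p : P ⟶ N
  projective : Projective P
  zero : i ≫ p = 0
  shortExact : (ShortComplex.mk i p zero).ShortExact
  extend : ∀ (Q : ModuleCat.{u} S), Projective Q → ∀ f : M ⟶ Q, ∃ g : P ⟶ Q, i ≫ g = f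

section

variable (M : ℤ → ModuleCat.{u} S) (s : ∀ n, ProjStep (M n) (M (n + 1)))

lemma gluedComplex_d_comp_d (n : ℤ) :
    ((s n).p ≫ (s (n + 1)).i) ≫ ((s (n + 1)).p ≫ (s (n + 1 + 1)).i) = 0 := by
  rw [Category.assoc, ← Category.assoc (s (n + 1)).i, (s (n + 1)).zero, zero_comp, comp_zero]

/-- The complex obtained by splicing short exact sequences. -/
noncomputable def gluedComplex : CochainComplex (ModuleCat.{u} S) ℤ :=
  CochainComplex.of (fun n => (s n).P) (fun n => (s n).p ≫ (s (n + 1)).i)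
    (gluedComplex_d_comp_d M s)

lemma gluedComplex_d (n : ℤ) :
    (gluedComplex M s).d n (n + 1) = (s n).p ≫ (s (n + 1)).i :=
  CochainComplex.of_d (fun n => (s n).P) (fun n => (s n).p ≫ (s (n + 1)).i) n

lemma gluedComplex_isTotallyAcyclic : IsTotallyAcyclic S (gluedComplex M s) where
  projective i := (s i).projective
  exact i := by
    obtain ⟨n, rfl⟩ : ∃ n, i = n + 1 := ⟨i - 1, by ring⟩
    rw [HomologicalComplex.exactAt_iff' _ n (n + 1) (n + 1 + 1) (by simp) (by simp),
      ShortComplex.moduleCat_exact_iff]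
    intro x hx
    change (s (n + 1)).P at x
    have hx' : (s (n + 1 + 1)).i ((s (n + 1)).p x) = 0 := by
      have : (gluedComplex M s).d (n + 1) (n + 1 + 1) x = 0 := hx
      rwa [gluedComplex_d] at this
    have := (s (n + 1 + 1)).shortExact.mono_f
    have hinj := (ModuleCat.mono_iff_injective (s (n + 1 + 1)).i).1 this
    have hpx : (s (n + 1)).p x = 0 := hinj (by rw [hx', map_zero])
    obtain ⟨m, hm⟩ := (ShortComplex.moduleCat_exact_iff _).1 (s (n + 1)).shortExact.exact x hpx
    have := (s n).shortExact.epi_g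
    obtain ⟨y, hy⟩ := (ModuleCat.epi_iff_surjective (s n).p).1 this m
    refine ⟨y, ?_⟩
    change (gluedComplex M s).d n (n + 1) y = x
    rw [gluedComplex_d, ← hm, ← hy]
    rfl
  hom_exact P hP i j k hij hjk f hf := by
    subst hij hjk
    change (s (i + 1)).P ⟶ P at f
    rw [gluedComplex_d] at hf
    have : Epi (s i).p := (s i).shortExact.epi_g
    -- A cocycle kills the image of the incoming differential, hence descends to the next syzygy,
    -- from which it extends by the `extend` field.
    have hf : (s (i + 1)).i ≫ f = 0 := by
      rw [← cancel_epi (s i).p, comp_zero, ← Category.assoc]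
      exact hf
    have hc := (s (i + 1)).shortExact.gIsCokernel
    obtain ⟨f', hf'⟩ := CokernelCofork.IsColimit.desc' hc f hf
    obtain ⟨g, hg⟩ := (s (i + 1 + 1)).extend P hP f'
    refine ⟨g, ?_⟩
    rw [gluedComplex_d]
    change ((s (i + 1)).p ≫ (s (i + 1 + 1)).i) ≫ g = f
    rw [Category.assoc, hg]
    exact hf'

include s in
lemma isGorensteinProjective_of_projStep : IsGorensteinProjective S (M 0) := by
  refine ⟨_, gluedComplex_isTotallyAcyclic M s, ⟨?_⟩⟩
  have h : (gluedComplex M s).d 0 1 = (s 0).p ≫ (s 1).i := gluedComplex_d M s 0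
  have hm : Mono (s 1).i := (s 1).shortExact.mono_f
  let e : M 0 ≅ kernel (s 0).p :=
    (s 0).shortExact.fIsKernel.conePointUniqueUpToIso (limit.isLimit _)
  exact e ≪≫ (kernelCompMono (s 0).p (s 1).i).symm ≪≫
    eqToIso (congrArg (fun f : (s 0).P ⟶ (s 1).P => kernel f) h.symm)

end

/-- A class of modules closed under syzygies and cosyzygies in projective modules consists of
Gorenstein-projective modules. -/
lemma isGorensteinProjective_of_class (C : ModuleCat.{u} S → Prop)
    (hleft : ∀ M, C M → ∃ N, C N ∧ Nonempty (ProjStep N M))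
    (hright : ∀ M, C M → ∃ N, C N ∧ Nonempty (ProjStep M N))
    (M : ModuleCat.{u} S) (hM : C M) : IsGorensteinProjective S M := by
  choose l hl hl' using fun M : {M // C M} => hleft M.1 M.2
  choose r hr hr' using fun M : {M // C M} => hright M.1 M.2
  let a (n : ℕ) : {M // C M} := (fun M => ⟨l M, hl M⟩)^[n] ⟨M, hM⟩
  let b (n : ℕ) : {M // C M} := (fun M => ⟨r M, hr M⟩)^[n] ⟨M, hM⟩
  have ha (n) : Nonempty (ProjStep (a (n + 1)).1 (a n).1) := by
    simp only [a, Function.iterate_succ_apply']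
    exact hl' _
  have hb (n) : Nonempty (ProjStep (b n).1 (b (n + 1)).1) := by
    simp only [b, Function.iterate_succ_apply']
    exact hr' _
  -- Cosyzygies go in degrees `≥ 0` and syzygies in negative degrees; `Int.negSucc n` is `-(n + 1)`,
  -- hence the shift of index.
  let F : ℤ → ModuleCat.{u} S
    | Int.ofNat n => (b n).1
    | Int.negSucc n => (a (n + 1)).1
  have hF (n : ℤ) : Nonempty (ProjStep (F n) (F (n + 1))) := by
    match n with
    | Int.ofNat n => exact hb n
    | Int.negSucc 0 => exact ha 0
    | Int.negSucc (n + 1) =>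
      have : Int.negSucc (n + 1) + 1 = Int.negSucc n := by omega
      rw [this]
      exact ha (n + 1)
  exact isGorensteinProjective_of_projStep F fun n => (hF n).some

end Gluing

end GorOrd

namespace GorOrd

/-! ### Maximal CM modules over a Gorenstein order are Gorenstein-projective. -/

open MulOpposite

/-- A Gorenstein order `A` over a Cohen-Macaulay local ring `R` with canonical module `ω`. -/
structure GorensteinSetup (R A ω : Type u) [CommRing R] [IsLocalRing R] [IsNoetherianRing R]
    [Ring A] [Algebra R A] [AddCommGroup ω] [Module R ω] : Prop where
  cm : IsCMLocalRing R
  canonical : IsCanonicalModule R (ModuleCat.of R ω)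
  order : IsMaximalCM R (ModuleCat.of R A)
  projective : Module.Projective Aᵐᵒᵖ (Coind R A ω)

/-- The restriction of scalars of an `Aᵐᵒᵖ`-module to `R`. -/
abbrev baseModule (R A : Type u) [CommRing R] [Ring A] [Algebra R A] (X : Type u)
    [AddCommGroup X] [Module Aᵐᵒᵖ X] : Module R X :=
  Module.compHom X (algebraMap R Aᵐᵒᵖ)

lemma baseModule_isScalarTower (R A : Type u) [CommRing R] [Ring A] [Algebra R A] (X : Type u)
    [AddCommGroup X] [Module Aᵐᵒᵖ X] :
    letI := baseModule R A X
    IsScalarTower R Aᵐᵒᵖ X := by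
  let _ := baseModule R A X
  refine ⟨fun r s x => ?_⟩
  rw [Algebra.smul_def, mul_smul]
  rfl

section

variable {R A ω : Type u} [CommRing R] [IsLocalRing R] [Ring A] [Algebra R A]
  {X Y Z : Type u} [AddCommGroup X] [AddCommGroup Y] [AddCommGroup Z]
  [Module R X] [Module R Y] [Module R Z] [Module Aᵐᵒᵖ X] [Module Aᵐᵒᵖ Y] [Module Aᵐᵒᵖ Z]
  [IsScalarTower R Aᵐᵒᵖ X] [IsScalarTower R Aᵐᵒᵖ Y] [IsScalarTower R Aᵐᵒᵖ Z]

variable (R X) in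
/-- The restriction of scalars of `X` agrees with a given compatible module structure. -/
def restrictScalarsEquiv :
    (ModuleCat.restrictScalars (algebraMap R Aᵐᵒᵖ)).obj (ModuleCat.of Aᵐᵒᵖ X) ≃ₗ[R] X where
  toFun x := x
  invFun x := x
  map_add' _ _ := rfl
  map_smul' r x := algebraMap_smul (M := X) Aᵐᵒᵖ r x
  left_inv _ := rfl
  right_inv _ := rfl

lemma isMaximalCMModule_iff :
    IsMaximalCMModule R A (ModuleCat.of Aᵐᵒᵖ X) ↔ IsMaximalCM R (ModuleCat.of R X) :=
  ⟨fun h => IsMaximalCM.of_linearEquiv (N := ModuleCat.of R X) (restrictScalarsEquiv R X) h,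
    fun h => IsMaximalCM.of_linearEquiv (M := ModuleCat.of R X) (restrictScalarsEquiv R X).symm h⟩

variable [AddCommGroup ω] [Module R ω] [IsNoetherianRing R] (h : GorensteinSetup R A ω)

namespace GorensteinSetup

include h

lemma finite : Module.Finite R A := h.order.finite

lemma isMaximalCM_op : IsMaximalCM R (ModuleCat.of R Aᵐᵒᵖ) :=
  h.order.congr (opLinearEquiv R)

lemma finite_op : Module.Finite R Aᵐᵒᵖ := h.isMaximalCM_op.finite

lemma isMaximalCM_coind : IsMaximalCM R (ModuleCat.of R (Coind R A ω)) :=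
  h.order.dual h.cm h.canonical

lemma finite_coind : Module.Finite Aᵐᵒᵖ (Coind R A ω) := by
  have : Module.Finite R (Coind R A ω) := h.isMaximalCM_coind.finite
  exact Module.Finite.of_restrictScalars_finite R _ _

lemma exists_retract : ∃ (n : ℕ) (i : Aᵐᵒᵖ →ₗ[Aᵐᵒᵖ] (Fin n → Coind R A ω))
    (p : (Fin n → Coind R A ω) →ₗ[Aᵐᵒᵖ] Aᵐᵒᵖ), p ∘ₗ i = LinearMap.id := by
  have := h.finite
  have := h.finite_coind
  have := h.projective
  exact Coind.exists_retract (h.order.bidual_bijective h.cm h.canonical)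

/-- By adjunction a map to `Hom_R(A, ω)` is an `R`-linear map to `ω`, and those extend because
`Ext¹_R(Z, ω) = 0`. The ring is a retract of a power of `Hom_R(A, ω)`, and finite generation of `X`
passes from the ring to all projective modules. -/
lemma exists_extension {f : X →ₗ[Aᵐᵒᵖ] Y} {g : Y →ₗ[Aᵐᵒᵖ] Z} (hf : Function.Injective f)
    (hg : Function.Surjective g) (hfg : Function.Exact f g)
    (hZ : IsMaximalCM R (ModuleCat.of R Z)) [Module.Finite Aᵐᵒᵖ X]
    {Q : Type u} [AddCommGroup Q] [Module Aᵐᵒᵖ Q] [Module.Projective Aᵐᵒᵖ Q]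
    (a : X →ₗ[Aᵐᵒᵖ] Q) : ∃ b : Y →ₗ[Aᵐᵒᵖ] Q, b ∘ₗ f = a := by
  refine exists_extension_of_projective f (fun a => ?_) a
  obtain ⟨n, i, p, hpi⟩ := h.exists_retract
  have hex (k : Fin n) : ∃ b : Y →ₗ[Aᵐᵒᵖ] Coind R A ω,
      b ∘ₗ f = LinearMap.proj k ∘ₗ i ∘ₗ a := by
    obtain ⟨c, hc⟩ := (hZ.extVanishes h.canonical one_pos).exists_extension
      (f := f.restrictScalars R) (g := g.restrictScalars R) hf hg hfg
      (Coind.ev ∘ₗ (LinearMap.proj k ∘ₗ i ∘ₗ a).restrictScalars R)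
    refine ⟨Coind.lift c, Coind.hom_ext fun x => ?_⟩
    have := LinearMap.congr_fun hc x
    simpa using this
  choose b hb using hex
  refine ⟨p ∘ₗ LinearMap.pi b, ?_⟩
  have : LinearMap.pi b ∘ₗ f = i ∘ₗ a := by
    ext1 x
    funext k
    exact LinearMap.congr_fun (hb k) x
  rw [LinearMap.comp_assoc, this, ← LinearMap.comp_assoc, hpi, LinearMap.id_comp]

lemma nonempty_projStep {f : X →ₗ[Aᵐᵒᵖ] Y} {g : Y →ₗ[Aᵐᵒᵖ] Z} (hf : Function.Injective f)
    (hg : Function.Surjective g) (hfg : Function.Exact f g)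
    (hX : IsMaximalCM R (ModuleCat.of R X)) (hZ : IsMaximalCM R (ModuleCat.of R Z))
    [Module.Projective Aᵐᵒᵖ Y] :
    Nonempty (ProjStep (ModuleCat.of Aᵐᵒᵖ X) (ModuleCat.of Aᵐᵒᵖ Z)) := by
  have : Module.Finite R X := hX.finite
  have : Module.Finite Aᵐᵒᵖ X := Module.Finite.of_restrictScalars_finite R _ _
  refine ⟨⟨ModuleCat.of Aᵐᵒᵖ Y, ModuleCat.ofHom f, ModuleCat.ofHom g,
    ModuleCat.projective_of_categoryTheory_projective _,
    by rw [← ModuleCat.ofHom_comp, hfg.linearMap_comp_eq_zero]; rfl, ?_, ?_⟩⟩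
  · exact
      { exact := by
          rw [ShortComplex.moduleCat_exact_iff]
          exact fun x hx => (hfg x).1 hx
        mono_f := (ModuleCat.mono_iff_injective _).2 hf
        epi_g := (ModuleCat.epi_iff_surjective _).2 hg }
  · intro Q hQ a
    have : Module.Projective Aᵐᵒᵖ Q := (IsProjective.iff_projective Q).2 hQ
    obtain ⟨b, hb⟩ := h.exists_extension hf hg hfg hZ a.hom
    exact ⟨ModuleCat.ofHom b, ModuleCat.hom_ext hb⟩

lemma exists_syzygy (hX : IsMaximalCM R (ModuleCat.of R X)) :
    ∃ N, IsMaximalCMModule R A N ∧ Nonempty (ProjStep N (ModuleCat.of Aᵐᵒᵖ X)) := by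
  have : Module.Finite R X := hX.finite
  have : Module.Finite Aᵐᵒᵖ X := Module.Finite.of_restrictScalars_finite R _ _
  obtain ⟨n, p, hp⟩ := Module.Finite.exists_fin' Aᵐᵒᵖ X
  have hex := LinearMap.exact_subtype_ker_map p
  have hK : IsMaximalCM R (ModuleCat.of R (LinearMap.ker p)) :=
    IsMaximalCM.left (f := (LinearMap.ker p).subtype.restrictScalars R)
      (g := p.restrictScalars R) (LinearMap.ker p).injective_subtype hp hex
      (h.isMaximalCM_op.pi n) hX
  exact ⟨ModuleCat.of Aᵐᵒᵖ (LinearMap.ker p), isMaximalCMModule_iff.2 hK,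
    h.nonempty_projStep (LinearMap.ker p).injective_subtype hp hex hK hX⟩

/-- Surjectivity of the dual map does double duty: with biduality it makes `j` injective, and it
makes the cokernel maximal CM. -/
lemma exists_cosyzygy_of_exact {j : X →ₗ[Aᵐᵒᵖ] Y} {g : Y →ₗ[Aᵐᵒᵖ] Z} [Module.Projective Aᵐᵒᵖ Y]
    (hg : Function.Surjective g) (hex : Function.Exact j g)
    (hjd : Function.Surjective (LinearMap.lcomp R ω (j.restrictScalars R)))
    (hX : IsMaximalCM R (ModuleCat.of R X)) (hY : IsMaximalCM R (ModuleCat.of R Y)) :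
    ∃ N, IsMaximalCMModule R A N ∧ Nonempty (ProjStep (ModuleCat.of Aᵐᵒᵖ X) N) := by
  have hj : Function.Injective j := by
    intro x y hxy
    refine (hX.bidual_bijective h.cm h.canonical).1 (LinearMap.ext fun a => ?_)
    obtain ⟨b, rfl⟩ := hjd a
    exact congrArg b hxy
  have hC : IsMaximalCM R (ModuleCat.of R Z) :=
    IsMaximalCM.right h.cm h.canonical (f := j.restrictScalars R)
      (g := g.restrictScalars R) hg hex hjd hX hY
  exact ⟨ModuleCat.of Aᵐᵒᵖ Z, isMaximalCMModule_iff.2 hC, h.nonempty_projStep hj hg hex hX hC⟩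

lemma exists_cosyzygy (hX : IsMaximalCM R (ModuleCat.of R X)) :
    ∃ N, IsMaximalCMModule R A N ∧ Nonempty (ProjStep (ModuleCat.of Aᵐᵒᵖ X) N) := by
  have := h.projective
  have hfin : Module.Finite R (X →ₗ[R] ω) := (hX.dual h.cm h.canonical).finite
  obtain ⟨n, q, hq⟩ := Module.Finite.exists_fin (R := R) (M := X →ₗ[R] ω)
  -- The components come from generators `q k` of `Hom_R(X, ω)`. Each `q k` is `j` followed by
  -- evaluation at `1` of the `k`-th component, so the dual of `j` is surjective.
  let j : X →ₗ[Aᵐᵒᵖ] (Fin n → Coind R A ω) := LinearMap.pi fun k => Coind.lift (q k)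
  have : Module.Projective Aᵐᵒᵖ (Fin n → Coind R A ω) :=
    Module.Projective.of_equiv (DFinsupp.linearEquivFunOnFintype (R := Aᵐᵒᵖ))
  refine h.exists_cosyzygy_of_exact (Submodule.mkQ_surjective _)
    (LinearMap.exact_map_mkQ_range j) ?_ hX (h.isMaximalCM_coind.pi n)
  rw [← LinearMap.range_eq_top, ← top_le_iff, ← hq, Submodule.span_le]
  rintro _ ⟨k, rfl⟩
  refine ⟨Coind.ev ∘ₗ LinearMap.proj k, LinearMap.ext fun x => ?_⟩
  change q k ((1 : Aᵐᵒᵖ) • x) = q k x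
  rw [one_smul]

/-- Maximal Cohen-Macaulay modules over a Gorenstein order are Gorenstein-projective. -/
lemma isGorensteinProjective (M : ModuleCat.{u} Aᵐᵒᵖ) (hM : IsMaximalCMModule R A M) :
    IsGorensteinProjective Aᵐᵒᵖ M := by
  refine isGorensteinProjective_of_class (IsMaximalCMModule R A) (fun N hN => ?_)
    (fun N hN => ?_) M hM
  all_goals
    let _ := baseModule R A N
    have := baseModule_isScalarTower R A N
    have hN' := (isMaximalCMModule_iff (X := N)).1 hN
  · exact h.exists_syzygy hN'
  · exact h.exists_cosyzygy hN'

end GorensteinSetup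

end

end GorOrd

namespace GorOrd

/-! ### Linear compactness over a complete local ring. -/

section LinearlyCompact

variable {R : Type u} [CommRing R] {M : Type u} [AddCommGroup M] [Module R M]

/-- Differences of consecutive terms are written in fixed generators with coefficients in `I ^ n`;
the partial sums of the coefficients converge in `R`. -/
lemma isPrecomplete_of_finite (I : Ideal R) [IsPrecomplete I R] [Module.Finite R M] :
    IsPrecomplete I M := by
  refine ⟨fun x hx => ?_⟩
  obtain ⟨m, e, he⟩ := Module.Finite.exists_fin (R := R) (M := M)
  have hstep (n : ℕ) : ∃ a : Fin m → R, (∀ j, a j ∈ I ^ n) ∧ ∑ j, a j • e j = x (n + 1) - x n := by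
    have h1 : x (n + 1) - x n ∈ I ^ n • Submodule.span R (Set.range e) := by
      rw [he]
      exact SModEq.sub_mem.1 (hx (Nat.le_succ n)).symm
    obtain ⟨a, ha, hs⟩ := (Submodule.mem_ideal_smul_span_iff_exists_sum _ _ _).1 h1
    refine ⟨a, ha, ?_⟩
    rw [← hs, Finsupp.sum_fintype _ _ (by simp)]
  choose a ha hs using hstep
  let b (j : Fin m) (n : ℕ) : R := ∑ k ∈ Finset.range n, a k j
  have hb (j : Fin m) : ∃ L, ∀ n, b j n ≡ L [SMOD (I ^ n • ⊤ : Submodule R R)] := by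
    refine IsPrecomplete.prec' (I := I) (b j) fun {p q} hpq => ?_
    rw [SModEq.comm, SModEq.sub_mem]
    simp only [b]
    rw [← Finset.sum_Ico_eq_sub _ hpq]
    refine sum_mem fun k hk => ?_
    rw [smul_eq_mul, Ideal.mul_top]
    exact Ideal.pow_le_pow_right (Finset.mem_Ico.1 hk).1 (ha k j)
  choose L hL using hb
  refine ⟨x 0 + ∑ j, L j • e j, fun n => ?_⟩
  have hxn : x n = x 0 + ∑ j, b j n • e j := by
    induction n with
    | zero => simp [b]
    | succ n ih =>
      have := hs n
      rw [eq_sub_iff_add_eq] at this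
      rw [← this, ih]
      simp only [b, Finset.sum_range_succ, add_smul, Finset.sum_add_distrib]
      abel
  rw [hxn, SModEq.sub_mem, add_sub_add_left_eq_sub, ← Finset.sum_sub_distrib]
  refine sum_mem fun j _ => ?_
  rw [← sub_smul]
  have := SModEq.sub_mem.1 (hL j n)
  rw [smul_eq_mul, Ideal.mul_top] at this
  exact Submodule.smul_mem_smul this trivial

/-- Finitely generated modules over a complete noetherian local ring are linearly compact. -/
lemma exists_mem_of_directed_cosets [IsLocalRing R] [IsNoetherianRing R]
    [IsAdicComplete (IsLocalRing.maximalIdeal R) R] [Module.Finite R M]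
    {ι : Type*} [Nonempty ι] (V : ι → Set M) (hne : ∀ i, (V i).Nonempty)
    (hV : ∀ i, ∃ N : Submodule R M, ∀ x ∈ V i, ∀ y, y ∈ V i ↔ y - x ∈ N)
    (hdir : ∀ i j, ∃ k, V k ⊆ V i ∧ V k ⊆ V j) : ∃ m, ∀ i, m ∈ V i := by
  set 𝔪 := IsLocalRing.maximalIdeal R
  choose N hN using hV
  have hNle {i j} (hij : V i ⊆ V j) : N i ≤ N j := by
    intro z hz
    obtain ⟨x, hx⟩ := hne i
    have h1 : x + z ∈ V i := (hN i x hx _).2 (by rwa [add_sub_cancel_left])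
    have h2 := (hN j x (hij hx) _).1 (hij h1)
    rwa [add_sub_cancel_left] at h2
  let I (n : ℕ) : Submodule R M := 𝔪 ^ n • ⊤
  -- Since `M / 𝔪^n M` is artinian, some direction module `N i` has minimal image there; shrinking
  -- the coset further changes nothing modulo `𝔪^n`.
  have hmin (n : ℕ) : ∃ i, ∀ k, V k ⊆ V i → N i ≤ N k ⊔ I n := by
    have := isArtinian_quotient_pow (R := R) M n
    obtain ⟨_, ⟨i, rfl⟩, hi⟩ := IsArtinian.set_has_minimal
      (Set.range fun i => (N i).map (I n).mkQ) (Set.range_nonempty _)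
    refine ⟨i, fun k hk => ?_⟩
    have h1 : (N k).map (I n).mkQ ≤ (N i).map (I n).mkQ := Submodule.map_mono (hNle hk)
    have h2 := eq_of_le_of_not_lt h1 (hi _ ⟨k, rfl⟩)
    have h3 := congrArg (Submodule.comap (I n).mkQ) h2
    rw [Submodule.comap_map_mkQ, Submodule.comap_map_mkQ] at h3
    rw [sup_comm, h3]
    exact le_sup_right
  choose c hc using hmin
  -- Every point of the minimal coset lies within `𝔪^n M` of every other coset. This yields a Cauchy
  -- sequence `x n ∈ V (c n)`.
  have hclose (n : ℕ) (x : M) (hx : x ∈ V (c n)) (i : ι) : ∃ v ∈ V i, v - x ∈ I n := by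
    obtain ⟨k, hki, hkc⟩ := hdir i (c n)
    obtain ⟨y, hy⟩ := hne k
    have h1 := (hN _ y (hkc hy) x).1 hx
    obtain ⟨a, ha, b, hb, hab⟩ := Submodule.mem_sup.1 (hc n k hkc h1)
    refine ⟨y + a, hki ((hN k y hy _).2 (by rwa [add_sub_cancel_left])), ?_⟩
    have : y + a - x = -b := by
      rw [eq_comm, sub_eq_iff_eq_add] at hab
      rw [hab]; abel
    rw [this]
    exact neg_mem hb
  have hseq : ∃ x : ℕ → M, (∀ n, x n ∈ V (c n)) ∧ ∀ n, x (n + 1) - x n ∈ I n := by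
    choose F hF hF' using fun (n : ℕ) (x : {x // x ∈ V (c n)}) =>
      hclose n x.1 x.2 (c (n + 1))
    let x : (n : ℕ) → {x // x ∈ V (c n)} := fun n =>
      Nat.rec ⟨(hne (c 0)).some, (hne (c 0)).some_mem⟩ (fun n x => ⟨F n x, hF n x⟩) n
    exact ⟨fun n => (x n).1, fun n => (x n).2, fun n => hF' n (x n)⟩
  obtain ⟨x, hxV, hx⟩ := hseq
  have := isPrecomplete_of_finite (M := M) 𝔪
  have hI : Antitone I := fun p q hpq => Submodule.smul_mono_left (Ideal.pow_le_pow_right hpq)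
  obtain ⟨L, hL⟩ := IsPrecomplete.prec' (I := 𝔪) x (fun {p q} hpq => by
    rw [SModEq.comm, SModEq.sub_mem]
    induction q, hpq using Nat.le_induction with
    | base => simp
    | succ q hq ih =>
      rw [← sub_add_sub_cancel _ (x q)]
      exact add_mem (hI hq (hx q)) ih)
  refine ⟨L, fun i => ?_⟩
  obtain ⟨y, hy⟩ := hne i
  rw [hN i y hy]
  -- Each coset is closed by Krull's intersection theorem for `M ⧸ N i`, so it contains the limit.
  have hH : IsHausdorff 𝔪 (M ⧸ N i) := inferInstance
  rw [← Submodule.Quotient.mk_eq_zero]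
  refine hH.haus _ fun n => ?_
  obtain ⟨v, hv, hvx⟩ := hclose n (x n) (hxV n) i
  rw [SModEq.zero]
  have h1 : L - y = (v - y) + (L - v) := by abel
  have h2 : L - v ∈ I n := by
    have : L - v = -(x n - L) + -(v - x n) := by abel
    rw [this]
    exact add_mem (neg_mem (SModEq.sub_mem.1 (hL n))) (neg_mem hvx)
  rw [h1, Submodule.Quotient.mk_add, (Submodule.Quotient.mk_eq_zero (N i)).2
    ((hN i y hy v).1 hv), zero_add]
  have h3 : Submodule.map (N i).mkQ (I n) ≤ 𝔪 ^ n • ⊤ := by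
    rw [Submodule.map_smul'']
    exact Submodule.smul_mono le_rfl le_top
  exact h3 ⟨_, h2, rfl⟩

end LinearlyCompact

/-! ### Pure-injectivity over complete local rings. -/

section PureInjective

variable {S : Type u} [Ring S]

/-- A set of prescribed values is finitely satisfiable if each finite part of it is the
restriction of a homomorphism. -/
def FinSatisfiable {F M : Type u} [AddCommGroup F] [AddCommGroup M] [Module S F] [Module S M]
    (G : Submodule S (F × M)) : Prop :=
  ∀ t : Finset (F × M), (t : Set (F × M)) ⊆ G → ∃ h : F →ₗ[S] M, ∀ p ∈ t, h p.1 = p.2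

/-- A maximal finitely satisfiable set of prescriptions is the graph of a homomorphism. Linear
compactness of `M` is what lets a value be prescribed at a new element. -/
lemma FinSatisfiable.exists_linearMap {R : Type u} [CommRing R] [IsLocalRing R]
    [IsNoetherianRing R] [IsAdicComplete (IsLocalRing.maximalIdeal R) R] [Algebra R S]
    {F M : Type u} [AddCommGroup F] [AddCommGroup M] [Module S F] [Module S M]
    [Module R M] [IsScalarTower R S M] [Module.Finite R M]
    (G : Submodule S (F × M)) (hG : FinSatisfiable G) :
    ∃ h : F →ₗ[S] M, ∀ p ∈ G, h p.1 = p.2 := by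
  classical
  obtain ⟨H, hGH, hH⟩ := zorn_le_nonempty₀ {H : Submodule S (F × M) | FinSatisfiable H}
    (fun c hc hchain H₀ hH₀ => by
      refine ⟨sSup c, fun t ht => ?_, fun _ h => le_sSup h⟩
      have hdir : DirectedOn (· ≤ ·) c := hchain.directedOn
      have : ∃ K ∈ c, (t : Set (F × M)) ⊆ K := by
        induction t using Finset.induction_on with
        | empty => exact ⟨H₀, hH₀, by simp⟩
        | insert p t hp ih =>
          rw [Finset.coe_insert, Set.insert_subset_iff] at ht
          obtain ⟨K, hK, hK'⟩ := ih ht.2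
          obtain ⟨K₁, hK₁, hp₁⟩ := (Submodule.mem_sSup_of_directed ⟨H₀, hH₀⟩ hdir).1 ht.1
          obtain ⟨K₂, hK₂, h1, h2⟩ := hdir K hK K₁ hK₁
          refine ⟨K₂, hK₂, ?_⟩
          rw [Finset.coe_insert, Set.insert_subset_iff]
          exact ⟨h2 hp₁, hK'.trans h1⟩
      obtain ⟨K, hK, hK'⟩ := this
      exact hc hK t hK') G hG
  have hsat : FinSatisfiable H := hH.prop
  have htotal (y : F) : ∃ m, (y, m) ∈ H := by
    let ι := {t : Finset (F × M) // (t : Set (F × M)) ⊆ H}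
    have : Nonempty ι := ⟨∅, by simp⟩
    -- The values at `y` allowed by the finite part `t` form a coset of an `R`-submodule, though not
    -- of an `S`-submodule in general. A common point `m` of all these cosets is compatible with
    -- every finite part.
    let V (t : ι) : Set M := {m | ∃ h : F →ₗ[S] M, (∀ p ∈ t.1, h p.1 = p.2) ∧ h y = m}
    obtain ⟨m, hm⟩ := exists_mem_of_directed_cosets (R := R) V
      (fun t => by
        obtain ⟨h, hh⟩ := hsat t.1 t.2
        exact ⟨h y, h, hh, rfl⟩)
      (fun t => by
        let N : Submodule R M :=
          { carrier := {m | ∃ h : F →ₗ[S] M, (∀ p ∈ t.1, h p.1 = 0) ∧ h y = m}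
            zero_mem' := ⟨0, by simp⟩
            add_mem' := by
              rintro _ _ ⟨h, hh, rfl⟩ ⟨h', hh', rfl⟩
              exact ⟨h + h', fun p hp => by simp [hh p hp, hh' p hp], by simp⟩
            smul_mem' := by
              rintro r _ ⟨h, hh, rfl⟩
              exact ⟨r • h, fun p hp => by simp [hh p hp], by simp⟩ }
        refine ⟨N, ?_⟩
        rintro _ ⟨h, hh, rfl⟩ z
        constructor
        · rintro ⟨h', hh', rfl⟩
          exact ⟨h' - h, fun p hp => by simp [hh p hp, hh' p hp], by simp⟩
        · rintro ⟨h', hh', hz⟩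
          refine ⟨h' + h, fun p hp => by simp [hh p hp, hh' p hp], ?_⟩
          rw [LinearMap.add_apply, hz, sub_add_cancel])
      (fun t t' => by
        refine ⟨⟨t.1 ∪ t'.1, by rw [Finset.coe_union]; exact Set.union_subset t.2 t'.2⟩, ?_, ?_⟩
        · rintro _ ⟨h, hh, rfl⟩
          exact ⟨h, fun p hp => hh p (Finset.mem_union_left _ hp), rfl⟩
        · rintro _ ⟨h, hh, rfl⟩
          exact ⟨h, fun p hp => hh p (Finset.mem_union_right _ hp), rfl⟩)
    refine ⟨m, ?_⟩
    have hsat' : FinSatisfiable (H ⊔ Submodule.span S {(y, m)}) := by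
      intro t ht
      have hdec (p : F × M) : ∃ q : F × M, q ∈ H ∧ (p ∈ t → ∃ s : S, p = q + s • (y, m)) := by
        by_cases hp : p ∈ t
        · obtain ⟨q, hq, z, hz, hqz⟩ := Submodule.mem_sup.1 (ht hp)
          obtain ⟨s, rfl⟩ := Submodule.mem_span_singleton.1 hz
          exact ⟨q, hq, fun _ => ⟨s, hqz.symm⟩⟩
        · exact ⟨0, zero_mem _, fun h => absurd h hp⟩
      choose q hq hq' using hdec
      obtain ⟨h, hh, hy⟩ := hm ⟨t.image q, by
        intro z hz
        obtain ⟨p, _, rfl⟩ := Finset.mem_image.1 hz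
        exact hq p⟩
      refine ⟨h, fun p hp => ?_⟩
      obtain ⟨s, hs⟩ := hq' p hp
      rw [hs]
      simp [hh (q p) (Finset.mem_image_of_mem q hp), hy]
    have := hH.le_of_ge hsat' le_sup_left
    exact this (Submodule.mem_sup_right (Submodule.mem_span_singleton_self _))
  have hfun {y : F} {m m' : M} (h1 : (y, m) ∈ H) (h2 : (y, m') ∈ H) : m = m' := by
    obtain ⟨h, hh⟩ := hsat {(y, m), (y, m')} (by
      intro z hz
      simp only [Finset.coe_insert, Finset.coe_singleton, Set.mem_insert_iff,
        Set.mem_singleton_iff] at hz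
      rcases hz with rfl | rfl <;> assumption)
    exact (hh (y, m) (by simp)).symm.trans (hh (y, m') (by simp))
  choose φ hφ using htotal
  refine ⟨{ toFun := φ
            map_add' := fun x y => hfun (hφ _) (H.add_mem (hφ x) (hφ y))
            map_smul' := fun s x => hfun (hφ _) (H.smul_mem s (hφ x)) }, fun p hp => ?_⟩
  exact hfun (hφ p.1) (hGH hp)

/-- The values prescribed by `g` on the preimage of the range of `f` in the free cover. -/
def prescribed {X Y M : Type u} [AddCommGroup X] [AddCommGroup Y] [AddCommGroup M] [Module S X]
    [Module S Y] [Module S M] (f : X →ₗ[S] Y) (g : X →ₗ[S] M) :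
    Submodule S ((Y →₀ S) × M) where
  carrier := {p | ∃ x, Finsupp.linearCombination S id p.1 = f x ∧ p.2 = g x}
  zero_mem' := ⟨0, by simp⟩
  add_mem' := by
    rintro p q ⟨x, hx, hx'⟩ ⟨y, hy, hy'⟩
    exact ⟨x + y, by simp [hx, hy], by simp [hx', hy']⟩
  smul_mem' := by
    rintro s p ⟨x, hx, hx'⟩
    exact ⟨s • x, by simp [hx], by simp [hx']⟩

lemma finSatisfiable_prescribed {X Y M : Type u} [AddCommGroup X] [AddCommGroup Y]
    [AddCommGroup M] [Module S X] [Module S Y] [Module S M] {f : X →ₗ[S] Y}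
    (hf : IsPureMono S f) (g : X →ₗ[S] M) : FinSatisfiable (prescribed f g) := by
  classical
  intro t ht
  let Y₀ : Finset Y := t.biUnion fun p => p.1.support
  let res : (Y →₀ S) →ₗ[S] (Y₀ →₀ S) := Finsupp.lsubtypeDomain (Y₀ : Set Y)
  let K : Submodule S (Y₀ →₀ S) := Submodule.span S (t.image fun p => res p.1 : Finset (Y₀ →₀ S))
  have hKfg : K.FG := ⟨_, rfl⟩
  -- The finitely many prescriptions, read modulo the range of `f`, become relations of a finitely
  -- presented module, to which purity applies.
  have : Module.FinitePresentation S ((Y₀ →₀ S) ⧸ K) :=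
    Module.finitePresentation_of_surjective K.mkQ K.mkQ_surjective (by rwa [Submodule.ker_mkQ])
  let w : (Y₀ →₀ S) →ₗ[S] Y := Finsupp.linearCombination S (fun y : Y₀ => (y : Y))
  have hw (p) (hp : p ∈ t) (v : Y → Y) :
      Finsupp.linearCombination S (fun y : Y₀ => v y) (res p.1) =
        Finsupp.linearCombination S v p.1 := by
    rw [Finsupp.linearCombination_apply, Finsupp.linearCombination_apply]
    refine Finsupp.sum_subtypeDomain_index (p := fun y => y ∈ (Y₀ : Set Y))
      (h := fun y s => s • v y) fun y hy => ?_
    exact Finset.mem_biUnion.2 ⟨p, hp, hy⟩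
  have hKle : K ≤ LinearMap.ker ((LinearMap.range f).mkQ ∘ₗ w) := by
    refine Submodule.span_le.2 fun z hz => ?_
    obtain ⟨p, hp, rfl⟩ := Finset.mem_image.1 (Finset.mem_coe.1 hz)
    obtain ⟨x, hx, -⟩ := ht hp
    have h1 : w (res p.1) = f x := (hw p hp id).trans hx
    rw [SetLike.mem_coe, LinearMap.mem_ker, LinearMap.comp_apply, h1]
    exact (Submodule.Quotient.mk_eq_zero _).2 ⟨x, rfl⟩
  obtain ⟨u, hu⟩ := hf.2 _ (K.liftQ _ hKle)
  -- `v y` agrees with `y` modulo the range of `f`, and the `v y` satisfy the relations in `K`.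
  -- Writing `y - v y = f (x y)`, the solution sends the basis element `y` to `g (x y)`; off `Y₀`
  -- the default `v y = y` permits `x y` with `f (x y) = 0`.
  let v (y : Y) : Y := if hy : y ∈ Y₀ then u (K.mkQ (Finsupp.single ⟨y, hy⟩ 1)) else y
  have hvr (y : Y) : ∃ x, f x = y - v y := by
    by_cases hy : y ∈ Y₀
    · have := LinearMap.congr_fun hu (K.mkQ (Finsupp.single ⟨y, hy⟩ 1))
      have h2 : (LinearMap.range f).mkQ (v y) = (LinearMap.range f).mkQ y := by
        simp only [v, hy, dite_true]
        refine this.trans ?_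
        simp [w]
      exact (Submodule.Quotient.eq (LinearMap.range f)).1 h2.symm
    · exact ⟨0, by simp [v, hy]⟩
  choose x hx using hvr
  refine ⟨Finsupp.linearCombination S (fun y => g (x y)), fun p hp => ?_⟩
  obtain ⟨x₀, hx₀, hp₂⟩ := ht hp
  have h1 : Finsupp.linearCombination S (fun y => g (x y)) p.1 =
      g (Finsupp.linearCombination S x p.1) :=
    (Finsupp.apply_linearCombination S g x p.1).symm
  have h2 : Finsupp.linearCombination S v p.1 = 0 := by
    rw [← hw p hp v]
    have h3 : (fun y : Y₀ => v y) = fun y => (u ∘ₗ K.mkQ) (Finsupp.single y 1) := by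
      funext y
      simp [v]
    have h4 : Finsupp.linearCombination S (fun y : Y₀ => v y) = u ∘ₗ K.mkQ := by
      rw [h3]
      ext y
      simp
    rw [h4, LinearMap.comp_apply, Submodule.mkQ_apply, (Submodule.Quotient.mk_eq_zero K).2, map_zero]
    exact Submodule.subset_span (Finset.mem_coe.2 (Finset.mem_image.2 ⟨p, hp, rfl⟩))
  have h5 : f (Finsupp.linearCombination S x p.1) = f x₀ := by
    rw [Finsupp.apply_linearCombination]
    have : f ∘ x = id - v := funext hx
    rw [this, ← hx₀]
    have h6 : Finsupp.linearCombination S (id - v) p.1 =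
        Finsupp.linearCombination S id p.1 - Finsupp.linearCombination S v p.1 := by
      simp [Finsupp.linearCombination_apply, Finsupp.sum, smul_sub]
    rw [h6, h2, sub_zero]
  rw [h1, hf.1 h5, hp₂]

/-- Modules over an `R`-algebra that are finitely generated over the complete noetherian local
ring `R` are pure-injective. -/
lemma isPureInjectiveModule_of_complete (R : Type u) [CommRing R] [IsLocalRing R]
    [IsNoetherianRing R] [IsAdicComplete (IsLocalRing.maximalIdeal R) R] [Algebra R S]
    (M : Type u) [AddCommGroup M] [Module S M]
    [Module R M] [IsScalarTower R S M] [Module.Finite R M] : IsPureInjectiveModule S M := by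
  intro X Y _ _ _ _ f hf g
  obtain ⟨h, hh⟩ := (finSatisfiable_prescribed hf g).exists_linearMap (R := R)
  let π : (Y →₀ S) →ₗ[S] Y := Finsupp.linearCombination S id
  have hπ : Function.Surjective π := fun y => ⟨Finsupp.single y 1, by simp [π]⟩
  have hk : LinearMap.ker π ≤ LinearMap.ker h := fun c hc =>
    hh (c, 0) ⟨0, by rw [map_zero]; exact hc, by simp⟩
  refine ⟨(LinearMap.ker π).liftQ h hk ∘ₗ (π.quotKerEquivOfSurjective hπ).symm.toLinearMap,
    LinearMap.ext fun x => ?_⟩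
  have h1 : (π.quotKerEquivOfSurjective hπ).symm (f x) =
      Submodule.Quotient.mk (Finsupp.single (f x) 1) := by
    rw [LinearEquiv.symm_apply_eq]
    simp [π]
  have h2 := hh (Finsupp.single (f x) 1, g x) ⟨x, by simp, rfl⟩
  simpa [h1] using h2

end PureInjective

end GorOrd

namespace GorOrd

/-! ### Syzygies and cosyzygies of Gorenstein-projective modules. -/

section ProjSteps

variable {S : Type u} [Ring S]

/-- Consecutive syzygies of a totally acyclic complex. -/
noncomputable def IsTotallyAcyclic.projStep {X : CochainComplex (ModuleCat.{u} S) ℤ}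
    (hX : IsTotallyAcyclic S X) (n m k : ℤ) (hnm : n + 1 = m) (hmk : m + 1 = k) :
    ProjStep (kernel (X.d n m)) (kernel (X.d m k)) := by
  have h0 := (X.exactAt_iff' n m k (by simp [← hnm]) (by simp [hmk])).1 (hX.exact m)
  have hepi : Epi (kernel.lift (X.d m k) (X.d n m) (X.d_comp_d n m k)) :=
    (ShortComplex.exact_iff_epi_kernel_lift _).1 h0
  have w : kernel.ι (X.d n m) ≫ kernel.lift (X.d m k) (X.d n m) (X.d_comp_d n m k) = 0 := by
    rw [← cancel_mono (kernel.ι _)]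
    simp
  refine ⟨X.X n, kernel.ι _, kernel.lift _ (X.d n m) (X.d_comp_d n m k), hX.projective n, w,
    { exact := ?_, mono_f := by dsimp; infer_instance, epi_g := hepi }, fun Q hQ f => ?_⟩
  · let φ : ShortComplex.mk _ _ w ⟶
        ShortComplex.mk (kernel.ι (X.d n m)) (X.d n m) (kernel.condition _) :=
      { τ₁ := 𝟙 _, τ₂ := 𝟙 _, τ₃ := kernel.ι (X.d m k) }
    have h₁ : Epi φ.τ₁ := inferInstanceAs (Epi (𝟙 _))
    have h₂ : IsIso φ.τ₂ := inferInstanceAs (IsIso (𝟙 _))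
    have h₃ : Mono φ.τ₃ := inferInstanceAs (Mono (kernel.ι (X.d m k)))
    exact (ShortComplex.exact_iff_of_epi_of_isIso_of_mono φ).2 (ShortComplex.exact_kernel _)
  · have h1 := (X.exactAt_iff' (n - 1) n m (by simp) (by simp [hnm])).1 (hX.exact n)
    have hepi' : Epi (kernel.lift (X.d n m) (X.d (n - 1) n) (X.d_comp_d (n - 1) n m)) :=
      (ShortComplex.exact_iff_epi_kernel_lift _).1 h1
    have hz : X.d (n - 2) (n - 1) ≫
        kernel.lift (X.d n m) (X.d (n - 1) n) (X.d_comp_d (n - 1) n m) = 0 := by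
      rw [← cancel_mono (kernel.ι _)]
      simp
    -- Pulled back along the epimorphism from `X^{n-1}` to the kernel, `f` becomes a cocycle, which
    -- acyclicity of `Hom(X, Q)` extends to `X^n`.
    obtain ⟨g, hg⟩ := hX.hom_exact Q hQ (n - 2) (n - 1) n (by ring) (by ring)
      (kernel.lift (X.d n m) (X.d (n - 1) n) (X.d_comp_d (n - 1) n m) ≫ f)
      (by rw [← Category.assoc, hz, zero_comp])
    refine ⟨g, ?_⟩
    rw [← cancel_epi (kernel.lift (X.d n m) (X.d (n - 1) n) (X.d_comp_d (n - 1) n m)), ← hg,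
      ← Category.assoc, kernel.lift_ι]

/-- Transport along isomorphisms. -/
noncomputable def ProjStep.congr {M M' N N' : ModuleCat.{u} S} (s : ProjStep M N) (e : M' ≅ M)
    (e' : N ≅ N') : ProjStep M' N' where
  P := s.P
  i := e.hom ≫ s.i
  p := s.p ≫ e'.hom
  projective := s.projective
  zero := by rw [Category.assoc, ← Category.assoc s.i, s.zero, zero_comp, comp_zero]
  shortExact := by
    refine ShortComplex.shortExact_of_iso
      (ShortComplex.isoMk (S₁ := ShortComplex.mk s.i s.p s.zero) e.symm (Iso.refl _) e' ?_ ?_)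
      s.shortExact
    · simp
    · simp
  extend Q hQ f := by
    obtain ⟨g, hg⟩ := s.extend Q hQ (e.inv ≫ f)
    exact ⟨g, by rw [Category.assoc, hg, Iso.hom_inv_id_assoc]⟩

lemma IsTotallyAcyclic.isGorensteinProjective {X : CochainComplex (ModuleCat.{u} S) ℤ}
    (hX : IsTotallyAcyclic S X) (n m : ℤ) (h : n + 1 = m) :
    IsGorensteinProjective S (kernel (X.d n m)) := by
  refine isGorensteinProjective_of_class
    (fun M => ∃ n m : ℤ, n + 1 = m ∧ Nonempty (M ≅ kernel (X.d n m))) ?_ ?_ _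
    ⟨n, m, h, ⟨Iso.refl _⟩⟩
  · rintro M ⟨n, m, rfl, ⟨e⟩⟩
    exact ⟨kernel (X.d (n - 1) n), ⟨n - 1, n, by ring, ⟨Iso.refl _⟩⟩,
      ⟨(hX.projStep (n - 1) n (n + 1) (by ring) rfl).congr (Iso.refl _) e.symm⟩⟩
  · rintro M ⟨n, m, rfl, ⟨e⟩⟩
    exact ⟨kernel (X.d (n + 1) (n + 1 + 1)), ⟨_, _, rfl, ⟨Iso.refl _⟩⟩,
      ⟨(hX.projStep n (n + 1) (n + 1 + 1) rfl rfl).congr e (Iso.refl _)⟩⟩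

lemma IsGorensteinProjective.exists_left {M : ModuleCat.{u} S} (hM : IsGorensteinProjective S M) :
    ∃ N, IsGorensteinProjective S N ∧ Nonempty (ProjStep N M) := by
  obtain ⟨X, hX, ⟨e⟩⟩ := hM
  exact ⟨_, hX.isGorensteinProjective (-1) 0 (by ring),
    ⟨(hX.projStep (-1) 0 1 (by ring) (by ring)).congr (Iso.refl _) e.symm⟩⟩

lemma IsGorensteinProjective.exists_right {M : ModuleCat.{u} S} (hM : IsGorensteinProjective S M) :
    ∃ N, IsGorensteinProjective S N ∧ Nonempty (ProjStep M N) := by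
  obtain ⟨X, hX, ⟨e⟩⟩ := hM
  exact ⟨_, hX.isGorensteinProjective 1 2 (by ring),
    ⟨(hX.projStep 0 1 2 (by ring) (by ring)).congr e (Iso.refl _)⟩⟩

end ProjSteps

/-! ### Direct sums of Gorenstein-projective modules. -/

section DirectSums

variable {S : Type u} [Ring S] {J : Type u}

/-- Direct sums of modules. -/
abbrev dsum (N : J → ModuleCat.{u} S) : ModuleCat.{u} S := ModuleCat.of S (Π₀ j, N j)

instance dsum_projective (P : J → ModuleCat.{u} S) [∀ j, Projective (P j)] :
    Projective (dsum P) := by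
  have (j : J) : Module.Projective S (P j) := (IsProjective.iff_projective _).2 inferInstance
  exact ModuleCat.projective_of_categoryTheory_projective _

open Classical in
/-- Direct sums of short exact sequences. -/
lemma nonempty_projStep_dsum {M N : J → ModuleCat.{u} S} (s : ∀ j, ProjStep (M j) (N j)) :
    Nonempty (ProjStep (dsum M) (dsum N)) := by
  have (j : J) : Projective (s j).P := (s j).projective
  let i := DFinsupp.mapRange.linearMap fun j => (s j).i.hom
  let p := DFinsupp.mapRange.linearMap fun j => (s j).p.hom
  have hex : LinearMap.ker p = LinearMap.range i := by
    rw [DFinsupp.ker_mapRangeLinearMap, DFinsupp.range_mapRangeLinearMap]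
    congr 2
    funext j
    exact ((ShortComplex.ShortExact.moduleCat_exact_iff_function_exact _).1
      (s j).shortExact.exact).linearMap_ker_eq
  refine ⟨⟨dsum fun j => (s j).P, ModuleCat.ofHom i, ModuleCat.ofHom p, inferInstance, ?_, ?_, ?_⟩⟩
  · rw [← ModuleCat.ofHom_comp, LinearMap.range_le_ker_iff.1 hex.ge]
    rfl
  · exact
      { exact := by
          rw [ShortComplex.moduleCat_exact_iff]
          exact fun x hx => hex.le hx
        mono_f := (ModuleCat.mono_iff_injective _).2
          ((DFinsupp.mapRange_injective _ fun _ => map_zero _).2 fun j =>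
            (ModuleCat.mono_iff_injective _).1 (s j).shortExact.mono_f)
        epi_g := (ModuleCat.epi_iff_surjective _).2
          ((DFinsupp.mapRange_surjective _ fun _ => map_zero _).2 fun j =>
            (ModuleCat.epi_iff_surjective _).1 (s j).shortExact.epi_g) }
  · intro Q hQ f
    choose g hg using fun j => (s j).extend Q hQ (ModuleCat.ofHom (f.hom ∘ₗ DFinsupp.lsingle (M := fun j => M j) j))
    refine ⟨ModuleCat.ofHom (DFinsupp.lsum ℕ fun j => (g j).hom), ?_⟩
    refine ModuleCat.hom_ext (DFinsupp.lhom_ext' fun j => LinearMap.ext fun x => ?_)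
    have := LinearMap.congr_fun (congrArg ModuleCat.Hom.hom (hg j)) x
    simpa [i] using this

lemma IsGorensteinProjective.dsum {N : J → ModuleCat.{u} S}
    (hN : ∀ j, IsGorensteinProjective S (N j)) : IsGorensteinProjective S (dsum N) := by
  refine isGorensteinProjective_of_class (fun M => ∃ N : J → ModuleCat.{u} S,
    (∀ j, IsGorensteinProjective S (N j)) ∧ M = GorOrd.dsum N) ?_ ?_ _ ⟨N, hN, rfl⟩
  · rintro _ ⟨N, hN, rfl⟩
    choose L hL s using fun j => (hN j).exists_left
    exact ⟨_, ⟨L, hL, rfl⟩, nonempty_projStep_dsum fun j => (s j).some⟩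
  · rintro _ ⟨N, hN, rfl⟩
    choose L hL s using fun j => (hN j).exists_right
    exact ⟨_, ⟨L, hL, rfl⟩, nonempty_projStep_dsum fun j => (s j).some⟩

end DirectSums

/-! ### Coproducts and compact objects in the stable category. -/

section Compact

variable {S : Type u} [Ring S]

instance : (stab S).Additive := Quotient.functor_additive _ stableRel_add

lemma stab_map_eq_iff {X Y : GProj S} (f g : X ⟶ Y) :
    (stab S).map f = (stab S).map g ↔ stableRel S f g :=
  Quotient.functor_map_eq_iff _ _ _

lemma stab_map_eq_zero_iff {X Y : GProj S} (f : X ⟶ Y) :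
    (stab S).map f = 0 ↔ ∃ (P : ModuleCat.{u} S) (_ : Projective P) (a : X.obj ⟶ P)
      (b : P ⟶ Y.obj), a ≫ b = f.hom := by
  rw [← (stab S).map_zero, stab_map_eq_iff]
  simp only [stableRel]
  have : f.hom - (0 : X ⟶ Y).hom = f.hom := sub_zero _
  rw [this]

variable {J : Type u} (N : J → GProj S)

/-- Direct sums of Gorenstein-projective modules. -/
abbrev gsum : GProj S := ⟨dsum fun j => (N j).obj, .dsum fun j => (N j).property⟩

open Classical in
/-- The inclusions into the direct sum. -/
noncomputable def gsumι (j : J) : N j ⟶ gsum N :=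
  ObjectProperty.homMk (ModuleCat.ofHom (DFinsupp.lsingle (M := fun j => (N j).obj) j))

/-- The projections from the direct sum. -/
noncomputable def gsumπ (j : J) : gsum N ⟶ N j :=
  ObjectProperty.homMk (ModuleCat.ofHom (DFinsupp.lapply (M := fun j => (N j).obj) j))

lemma gsumι_π_self (j : J) : gsumι N j ≫ gsumπ N j = 𝟙 _ := by
  classical
  refine ObjectProperty.hom_ext _ (ModuleCat.hom_ext (LinearMap.ext fun x => ?_))
  exact DFinsupp.single_eq_same (β := fun j => (N j).obj) (i := j) (b := x)

lemma gsumι_π_of_ne {j k : J} (h : j ≠ k) : gsumι N j ≫ gsumπ N k = 0 := by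
  classical
  refine ObjectProperty.hom_ext _ (ModuleCat.hom_ext (LinearMap.ext fun x => ?_))
  exact DFinsupp.single_eq_of_ne (β := fun j => (N j).obj) (b := x) h.symm

variable {N}

open Classical in
/-- The morphism from the direct sum with given components. -/
noncomputable def gsumDesc {T : GProj S} (f : ∀ j, N j ⟶ T) : gsum N ⟶ T :=
  ObjectProperty.homMk (ModuleCat.ofHom (DFinsupp.lsum ℕ fun j => (f j).hom.hom))

lemma gsumι_desc {T : GProj S} (f : ∀ j, N j ⟶ T) (j : J) : gsumι N j ≫ gsumDesc f = f j := by
  classical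
  refine ObjectProperty.hom_ext _ (ModuleCat.hom_ext (LinearMap.ext fun x => ?_))
  simp [gsumι, gsumDesc]

lemma stab_map_gsumι_desc {T : GProj S} (f : ∀ j, N j ⟶ T) (j : J) :
    (stab S).map (gsumι N j) ≫ (stab S).map (gsumDesc f) = (stab S).map (f j) := by
  rw [← Functor.map_comp, gsumι_desc]

/-- If each component of the difference factors through a projective `P j`, the whole difference
factors through the direct sum of the `P j`, again projective. -/
lemma gsum_hom_ext {T : StableGProj S} {f g : (stab S).obj (gsum N) ⟶ T}
    (h : ∀ j, (stab S).map (gsumι N j) ≫ f = (stab S).map (gsumι N j) ≫ g) : f = g := by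
  classical
  obtain ⟨a, ha⟩ := (stab S).map_surjective (X := gsum N) (Y := T.as) (f - g)
  have h0 (j : J) : (stab S).map (gsumι N j ≫ a) = 0 := by
    rw [Functor.map_comp, ha, Preadditive.comp_sub, sub_eq_zero]
    exact h j
  simp only [stab_map_eq_zero_iff] at h0
  choose P hP c b hcb using h0
  rw [← sub_eq_zero, ← ha, stab_map_eq_zero_iff]
  refine ⟨dsum P, inferInstance,
    ModuleCat.ofHom (DFinsupp.mapRange.linearMap fun j => (c j).hom),
    ModuleCat.ofHom (DFinsupp.lsum ℕ fun j => (b j).hom), ?_⟩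
  refine ModuleCat.hom_ext (DFinsupp.lhom_ext' fun j => LinearMap.ext fun x => ?_)
  have := LinearMap.congr_fun (congrArg ModuleCat.Hom.hom (hcb j)) x
  simpa [gsumι] using this

variable (N) in
/-- The direct sum, as a cofan in the stable category. -/
noncomputable abbrev gsumCofan : Cofan fun j => (stab S).obj (N j) :=
  Cofan.mk ((stab S).obj (gsum N)) fun j => (stab S).map (gsumι N j)

lemma exists_gsumCofan_desc (t : Cofan fun j => (stab S).obj (N j)) :
    ∃ d : (stab S).obj (gsum N) ⟶ t.pt, ∀ j, (stab S).map (gsumι N j) ≫ d = t.inj j := by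
  choose f hf using fun j => (stab S).map_surjective (X := N j) (Y := t.pt.as) (t.inj j)
  exact ⟨(stab S).map (gsumDesc f), fun j => (stab_map_gsumι_desc f j).trans (hf j)⟩

variable (N) in
/-- Direct sums of Gorenstein-projective modules are coproducts in the stable category. -/
noncomputable def isColimitGsumCofan : IsColimit (gsumCofan N) :=
  Cofan.IsColimit.mk _ (fun t => (exists_gsumCofan_desc t).choose)
    (fun t => (exists_gsumCofan_desc t).choose_spec)
    (fun t _ hm => gsum_hom_ext fun j =>
      (hm j).trans ((exists_gsumCofan_desc t).choose_spec j).symm)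

open Classical in
variable (N) in
/-- The comparison map for morphisms to a direct sum. -/
noncomputable def homGsum (C : StableGProj S) :
    (DirectSum J fun j => C ⟶ (stab S).obj (N j)) →+ (C ⟶ (stab S).obj (gsum N)) :=
  DirectSum.toAddMonoid fun j => Preadditive.rightComp C ((stab S).map (gsumι N j))

lemma homGsum_π {C : StableGProj S} (x : DirectSum J fun j => C ⟶ (stab S).obj (N j)) (k : J) :
    homGsum N C x ≫ (stab S).map (gsumπ N k) = x k := by
  classical
  induction x using DirectSum.induction_on with
  | zero => simp
  | of j f =>
    rw [homGsum, DirectSum.toAddMonoid_of]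
    change (f ≫ (stab S).map (gsumι N j)) ≫ (stab S).map (gsumπ N k) = _
    rw [Category.assoc, ← Functor.map_comp]
    by_cases h : j = k
    · subst h
      rw [gsumι_π_self, (stab S).map_id, DirectSum.of_eq_same]
      exact Category.comp_id f
    · rw [gsumι_π_of_ne N h, Functor.map_zero, comp_zero, DirectSum.of_eq_of_ne _ _ _ (Ne.symm h)]
  | add x y hx hy => rw [map_add, Preadditive.add_comp, hx, hy, DirectSum.add_apply]

lemma homGsum_injective (C : StableGProj S) : Function.Injective (homGsum N C) := by
  intro x y h
  refine DFinsupp.ext fun k => ?_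
  rw [← homGsum_π x k, h, homGsum_π]

/-- A representing module map from a finitely generated `C` meets only finitely many summands, so it
is the finite sum of its components. -/
lemma homGsum_surjective (C : GProj S) [hC : Module.Finite S C.obj] :
    Function.Surjective (homGsum N ((stab S).obj C)) := by
  classical
  intro φ
  obtain ⟨a, rfl⟩ := (stab S).map_surjective (X := C) (Y := gsum N) φ
  obtain ⟨t, ht⟩ := hC.fg_top
  let a' : C.obj →ₗ[S] Π₀ j, (N j).obj := a.hom.hom
  let s : Finset J := t.biUnion fun c => (a' c).support
  have hs (c : C.obj) (j : J) (hj : j ∉ s) : a' c j = 0 := by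
    have hc : c ∈ Submodule.span S (t : Set C.obj) := ht ▸ trivial
    induction hc using Submodule.span_induction with
    | mem c hc =>
      by_contra h
      exact hj (Finset.mem_biUnion.2 ⟨c, hc, DFinsupp.mem_support_iff.2 h⟩)
    | zero => simp
    | add x y _ _ hx hy => simp [hx, hy]
    | smul r x _ hx => simp [hx]
  have hsum : a = ∑ j ∈ s, (a ≫ gsumπ N j) ≫ gsumι N j := by
    refine ObjectProperty.hom_ext _ (ModuleCat.hom_ext (LinearMap.ext fun c => ?_))
    have h1 : (∑ j ∈ s, (a ≫ gsumπ N j) ≫ gsumι N j).hom.hom c =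
        ∑ j ∈ s, DFinsupp.single j (a' c j) := by
      have h2 (f : C ⟶ gsum N) : f.hom.hom = (ModuleCat.homAddEquiv.toAddMonoidHom.comp
        ((IsGorensteinProjective S).ι.mapAddHom (X := C) (Y := gsum N))) f := rfl
      rw [h2, map_sum, LinearMap.sum_apply]
      rfl
    refine Eq.trans ?_ h1.symm
    refine DFinsupp.ext fun k => ?_
    change a' c k = _
    rw [DFinsupp.finsetSum_apply]
    by_cases hk : k ∈ s
    · rw [Finset.sum_eq_single_of_mem k hk, DFinsupp.single_eq_same]
      intro j _ hjk
      exact DFinsupp.single_eq_of_ne hjk.symm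
    · rw [hs c k hk, Finset.sum_eq_zero]
      intro j hj
      refine DFinsupp.single_eq_of_ne ?_
      rintro rfl
      exact hk hj
  refine ⟨∑ j ∈ s, DirectSum.of (fun j => (stab S).obj C ⟶ (stab S).obj (N j)) j
    ((stab S).map (a ≫ gsumπ N j)), ?_⟩
  conv_rhs => rw [hsum]
  rw [map_sum, Functor.map_sum]
  refine Finset.sum_congr rfl fun j _ => ?_
  rw [homGsum, DirectSum.toAddMonoid_of, Functor.map_comp _ (a ≫ gsumπ N j)]
  rfl

open Classical in
/-- A group with an isomorphism from a direct sum is a coproduct. -/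
noncomputable def isColimitOfDirectSumEquiv {G : J → Type u} [∀ j, AddCommGroup (G j)] {H : Type u}
    [AddCommGroup H] (e : DirectSum J G ≃+ H) (i : ∀ j, G j →+ H)
    (he : ∀ j x, e (DirectSum.of G j x) = i j x) :
    IsColimit (Cofan.mk (f := fun j => AddCommGrpCat.of (G j)) (AddCommGrpCat.of H)
      fun j => AddCommGrpCat.ofHom (i j)) :=
  Cofan.IsColimit.mk _
    (fun t => AddCommGrpCat.ofHom
      ((DirectSum.toAddMonoid fun j => (t.inj j).hom).comp e.symm.toAddMonoidHom))
    (fun t j => by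
      refine AddCommGrpCat.hom_ext (AddMonoidHom.ext fun x => ?_)
      change DirectSum.toAddMonoid (fun j => (t.inj j).hom) (e.symm (i j x)) = (t.inj j).hom x
      rw [← he, AddEquiv.symm_apply_apply]
      exact DirectSum.toAddMonoid_of (fun j => (t.inj j).hom) j x)
    (fun t m hm => by
      have h : (AddCommGrpCat.Hom.hom (X := AddCommGrpCat.of H) m).comp e.toAddMonoidHom =
          DirectSum.toAddMonoid fun j => (t.inj j).hom := by
        refine DirectSum.addHom_ext fun j x => ?_
        refine Eq.trans ?_ (DirectSum.toAddMonoid_of (fun j => (t.inj j).hom) j x).symm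
        change m.hom (e _) = _
        rw [he]
        exact congrArg (fun f => f.hom x) (hm j)
      refine AddCommGrpCat.hom_ext (AddMonoidHom.ext fun y => ?_)
      have := DFunLike.congr_fun h (e.symm y)
      refine Eq.trans ?_ this
      exact congrArg m.hom (e.apply_symm_apply y).symm)

/-- Finitely generated Gorenstein-projective modules are compact in the stable category. -/
lemma isCompactObject_of_finite (C : GProj S) [Module.Finite S C.obj] :
    IsCompactObject ((stab S).obj C) := by
  classical
  refine fun J => ⟨fun {K} => ?_⟩
  let N (j : J) : GProj S := (K.obj ⟨j⟩).as
  let F := preadditiveCoyoneda.obj (Opposite.op ((stab S).obj C))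
  suffices PreservesColimit (Discrete.functor fun j => (stab S).obj (N j)) F by
    have : PreservesColimit (Discrete.functor (K.obj ∘ Discrete.mk)) F := this
    exact preservesColimit_of_iso_diagram F (Discrete.natIsoFunctor (F := K)).symm
  refine preservesColimit_of_preserves_colimit_cocone (isColimitGsumCofan N)
    ((isColimitMapCoconeCofanMkEquiv _ _ _).symm ?_)
  let e := AddEquiv.ofBijective (homGsum N ((stab S).obj C))
    ⟨homGsum_injective _, homGsum_surjective C⟩
  have he (j : J) (x : (stab S).obj C ⟶ (stab S).obj (N j)) :
      e (DirectSum.of (fun j => (stab S).obj C ⟶ (stab S).obj (N j)) j x) =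
        x ≫ (stab S).map (gsumι N j) :=
    DirectSum.toAddMonoid_of (fun j => Preadditive.rightComp _ ((stab S).map (gsumι N j))) j x
  exact isColimitOfDirectSumEquiv e
    (fun j => Preadditive.rightComp _ ((stab S).map (gsumι N j))) he

end Compact

end GorOrd

namespace GorOrd

/-! ### Factoring maps through finitely generated Gorenstein-projective modules. -/

section Lifting

variable {S : Type u} [Ring S] {X Y Z W : Type u} [AddCommGroup X] [AddCommGroup Y]
  [AddCommGroup Z] [AddCommGroup W] [Module S X] [Module S Y] [Module S Z] [Module S W]

lemma exists_lift_of_exact {i : X →ₗ[S] Y} {p : Y →ₗ[S] Z} (hi : Function.Injective i)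
    (hex : Function.Exact i p) (f : W →ₗ[S] Y) (hf : ∀ x, p (f x) = 0) :
    ∃ g : W →ₗ[S] X, ∀ x, i (g x) = f x := by
  refine ⟨(LinearEquiv.ofInjective i hi).symm.toLinearMap ∘ₗ
    f.codRestrict (LinearMap.range i) fun x => (hex _).1 (hf x), fun x => ?_⟩
  exact congrArg Subtype.val ((LinearEquiv.ofInjective i hi).apply_symm_apply
    ⟨f x, (hex _).1 (hf x)⟩)

end Lifting

section

variable {R A : Type u} [CommRing R] [IsLocalRing R] [Ring A] [Algebra R A]

lemma DepthGE.prod {X Y : Type u} [AddCommGroup X] [AddCommGroup Y] [Module R X] [Module R Y]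
    {n : ℕ} (hX : DepthGE R n X) (hY : DepthGE R n Y) : DepthGE R n (X × Y) :=
  DepthGE.middle (f := LinearMap.inl R X Y) (g := LinearMap.snd R X Y) LinearMap.inl_injective
    LinearMap.snd_surjective (LinearMap.exact_iff.2 (LinearMap.range_inl R X Y).symm) hX hY

omit [IsLocalRing R] in
/-- Homomorphisms from a finitely generated module to the ring extend along some homomorphism to
a finitely generated free module. -/
lemma exists_left_approximation {S : Type u} [Ring S] [Algebra R S] [IsNoetherianRing R]
    [Module.Finite R S] (G : Type u) [AddCommGroup G] [Module S G] [Module R G]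
    [IsScalarTower R S G] [Module.Finite S G] :
    ∃ (m : ℕ) (j : G →ₗ[S] (Fin m → S)), ∀ a : G →ₗ[S] S, ∃ b : (Fin m → S) →ₗ[S] S,
      b ∘ₗ j = a := by
  have : Module.Finite R G := Module.Finite.trans S G
  have : Module.Finite R (G →ₗ[R] S) := finite_linearMap
  have : Module.Finite R (G →ₗ[S] S) := Module.Finite.of_injective
    (LinearMap.restrictScalarsₗ R S G S R) (LinearMap.restrictScalars_injective R)
  obtain ⟨m, q, hq⟩ := Module.Finite.exists_fin (R := R) (M := G →ₗ[S] S)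
  refine ⟨m, LinearMap.pi q, fun a => ?_⟩
  have ha : a ∈ Submodule.span R (Set.range q) := hq ▸ trivial
  induction ha using Submodule.span_induction with
  | mem a ha =>
    obtain ⟨k, rfl⟩ := ha
    exact ⟨LinearMap.proj k, rfl⟩
  | zero => exact ⟨0, rfl⟩
  | add a a' _ _ h h' =>
    obtain ⟨b, rfl⟩ := h
    obtain ⟨b', rfl⟩ := h'
    exact ⟨b + b', rfl⟩
  | smul r a _ h =>
    obtain ⟨b, rfl⟩ := h
    exact ⟨r • b, rfl⟩

variable {ω : Type u} [IsNoetherianRing R] [AddCommGroup ω] [Module R ω]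
  (h : GorensteinSetup R A ω)

namespace GorensteinSetup

include h

/-- Homomorphisms from finitely generated to Gorenstein-projective modules factor through finitely
generated modules of large depth. -/
lemma exists_factorization {d : ℕ} (hd : ringKrullDim R = d) (n : ℕ) (hn : n ≤ d)
    (G F : Type u) [AddCommGroup G] [AddCommGroup F] [Module Aᵐᵒᵖ G] [Module Aᵐᵒᵖ F]
    [Module.Finite Aᵐᵒᵖ G] (hF : IsGorensteinProjective Aᵐᵒᵖ (ModuleCat.of Aᵐᵒᵖ F))
    (g : G →ₗ[Aᵐᵒᵖ] F) :
    ∃ (H : Type u) (_ : AddCommGroup H) (_ : Module Aᵐᵒᵖ H) (_ : Module R H)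
      (_ : IsScalarTower R Aᵐᵒᵖ H) (_ : Module.Finite Aᵐᵒᵖ H) (a : G →ₗ[Aᵐᵒᵖ] H)
      (b : H →ₗ[Aᵐᵒᵖ] F), DepthGE R n H ∧ b ∘ₗ a = g := by
  let _ := baseModule R A G
  have := baseModule_isScalarTower R A G
  have := h.finite_op
  induction n generalizing G F with
  | zero => exact ⟨G, _, _, _, ‹_›, ‹_›, LinearMap.id, g, fun i hi => absurd hi (by simp), rfl⟩
  | succ n ih =>
    have hS : DepthGE R d Aᵐᵒᵖ := ((isMaximalCM_iff hd).1 h.isMaximalCM_op).2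
    obtain ⟨F₁, hF₁, ⟨s⟩⟩ := hF.exists_right
    have hP : Module.Projective Aᵐᵒᵖ s.P := (IsProjective.iff_projective _).2 s.projective
    have hi : Function.Injective s.i := (ModuleCat.mono_iff_injective _).1 s.shortExact.mono_f
    have hp : Function.Surjective s.p := (ModuleCat.epi_iff_surjective _).1 s.shortExact.epi_g
    have hex : Function.Exact s.i.hom s.p.hom :=
      (ShortComplex.ShortExact.moduleCat_exact_iff_function_exact _).1 s.shortExact.exact
    -- The composite `G → F → P` extends along `j`, which need not be injective, to `v`. Passing to
    -- cokernels gives a map from `coker j` to the cosyzygy `F₁`, to which the induction hypothesis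
    -- applies.
    obtain ⟨m, j, hj⟩ := exists_left_approximation (R := R) (S := Aᵐᵒᵖ) G
    obtain ⟨v, hv⟩ := exists_extension_of_projective j hj (s.i.hom ∘ₗ g)
    replace hv (x) : v (j x) = s.i.hom (g x) := LinearMap.congr_fun hv x
    have hker : LinearMap.range j ≤ LinearMap.ker (s.p.hom ∘ₗ v) := by
      rintro _ ⟨x, rfl⟩
      rw [LinearMap.mem_ker, LinearMap.comp_apply, hv]
      exact hex.apply_apply_eq_zero _
    obtain ⟨H, _, _, _, _, _, a, b, hH, hab⟩ := ih (by omega) _ F₁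
      hF₁ ((LinearMap.range j).liftQ _ hker)
      (baseModule_isScalarTower R A _)
    replace hab (x) : b (a (Submodule.Quotient.mk x)) = s.p.hom (v x) :=
      LinearMap.congr_fun hab (Submodule.Quotient.mk x)
    obtain ⟨l, π, hπ⟩ := Module.Finite.exists_fin' Aᵐᵒᵖ H
    obtain ⟨q, hq⟩ := Module.projective_lifting_property π (a ∘ₗ (LinearMap.range j).mkQ) hπ
    replace hq (x) : π (q x) = a (Submodule.Quotient.mk x) := LinearMap.congr_fun hq x
    obtain ⟨c, hc⟩ := Module.projective_lifting_property s.p.hom (b ∘ₗ π) hp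
    replace hc (x) : s.p.hom (c x) = b (π x) := LinearMap.congr_fun hc x
    -- Both `v` and `c ∘ q` cover the same map to `F₁`, so their difference lands in `F`; so does
    -- `c` on `ker π`. On the image of `G` the two corrections add up to `v ∘ j`, that is, to `g`.
    obtain ⟨σ, hσ⟩ := exists_lift_of_exact hi hex (v - c ∘ₗ q) fun x => by
      rw [LinearMap.sub_apply, map_sub, LinearMap.comp_apply, hc, hq, hab, sub_self]
    obtain ⟨τ, hτ⟩ := exists_lift_of_exact hi hex (c ∘ₗ (LinearMap.ker π).subtype) fun x => by
      rw [LinearMap.comp_apply, hc, Submodule.subtype_apply, LinearMap.mem_ker.1 x.2, map_zero]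
    have hqj (x) : q (j x) ∈ LinearMap.ker π := by
      rw [LinearMap.mem_ker, hq, (Submodule.Quotient.mk_eq_zero (LinearMap.range j)).2 ⟨x, rfl⟩, map_zero]
    have : IsNoetherianRing Aᵐᵒᵖ := IsNoetherianRing.of_finite R _
    refine ⟨LinearMap.ker π × (Fin m → Aᵐᵒᵖ), inferInstance, inferInstance, inferInstance,
      inferInstance, inferInstance, ((q ∘ₗ j).codRestrict _ hqj).prod j, τ.coprod σ, ?_, ?_⟩
    -- `ker π` is a syzygy of `H` and has one more unit of depth; the free modules have depth at
    -- least `d`, whence the restriction `n ≤ d`.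
    · refine DepthGE.prod ?_ ((hS.mono hn).pi m)
      exact DepthGE.left (f := (LinearMap.ker π).subtype.restrictScalars R)
        (g := π.restrictScalars R) (LinearMap.ker π).injective_subtype hπ
        (LinearMap.exact_subtype_ker_map π) ((hS.mono hn).pi l) hH
    · refine LinearMap.ext fun x => hi ?_
      have h1 : s.i.hom (τ ⟨q (j x), hqj x⟩ + σ (j x)) = s.i.hom (g x) := by
        rw [map_add, hτ, hσ, ← hv]
        simp
      exact h1

/-- Homomorphisms from finitely generated to Gorenstein-projective modules factor through finitely
generated Gorenstein-projective modules. -/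
lemma exists_gorensteinProjective_factorization (G : Type u) [AddCommGroup G] [Module Aᵐᵒᵖ G]
    [Module.Finite Aᵐᵒᵖ G] (F : GProj Aᵐᵒᵖ) (g : G →ₗ[Aᵐᵒᵖ] F.obj) :
    ∃ (C : GProj Aᵐᵒᵖ) (_ : Module.Finite Aᵐᵒᵖ C.obj) (a : G →ₗ[Aᵐᵒᵖ] C.obj)
      (b : C.obj →ₗ[Aᵐᵒᵖ] F.obj), b ∘ₗ a = g := by
  obtain ⟨d, hd⟩ := exists_ringKrullDim_eq (R := R)
  obtain ⟨H, _, _, _, _, _, a, b, hH, hab⟩ :=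
    h.exists_factorization hd d le_rfl G F.obj F.property g
  have := h.finite_op
  have : Module.Finite R H := Module.Finite.trans Aᵐᵒᵖ H
  have hM : IsMaximalCM R (ModuleCat.of R H) := (isMaximalCM_iff hd).2 ⟨this, hH⟩
  exact ⟨⟨ModuleCat.of Aᵐᵒᵖ H, h.isGorensteinProjective _ (isMaximalCMModule_iff.2 hM)⟩, ‹_›,
    a, b, hab⟩

end GorensteinSetup

end

end GorOrd

namespace GorOrd

/-! ### From pure triangles to pure monomorphisms. -/

section PureTriangles

variable {S : Type u} [Ring S] {E F : GProj S} {b : E ⟶ F}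

/-- Stable lifts along an epimorphism of modules can be corrected to lifts. -/
lemma exists_lift_of_stab_lift (hb : Epi b.hom) {C : GProj S} (t : C ⟶ F) (v : C ⟶ E)
    (hv : (stab S).map v ≫ (stab S).map b = (stab S).map t) :
    ∃ t' : C ⟶ E, t' ≫ b = t := by
  rw [← Functor.map_comp, eq_comm, stab_map_eq_iff] at hv
  obtain ⟨P, hP, c, e, hce⟩ := hv
  -- The error `t - v ≫ b` factors through a projective module, and that factor lifts along the
  -- epimorphism `b`.
  refine ⟨v + ObjectProperty.homMk (c ≫ Projective.factorThru e b.hom), ?_⟩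
  refine ObjectProperty.hom_ext _ ?_
  change (v.hom + c ≫ Projective.factorThru e b.hom) ≫ b.hom = t.hom
  rw [Preadditive.add_comp, Category.assoc, Projective.factorThru_comp, hce]
  change v.hom ≫ b.hom + (t.hom - v.hom ≫ b.hom) = t.hom
  abel

variable {M : GProj S} {a : M ⟶ E} {w : a.hom ≫ b.hom = 0}

/-- If homomorphisms from finitely generated Gorenstein-projective modules lift along `b`, and
homomorphisms from finitely generated modules factor through such modules, then the kernel of `b`
is pure. -/
lemma isPureMono_of_lift (hs : (ShortComplex.mk a.hom b.hom w).ShortExact)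
    (hfac : ∀ (G : Type u) [AddCommGroup G] [Module S G] [Module.Finite S G]
      (g : G →ₗ[S] F.obj), ∃ (C : GProj S) (_ : Module.Finite S C.obj) (k : G →ₗ[S] C.obj)
        (t : C.obj →ₗ[S] F.obj), t ∘ₗ k = g)
    (hlift : ∀ (C : GProj S) [Module.Finite S C.obj] (t : C ⟶ F), ∃ t' : C ⟶ E, t' ≫ b = t) :
    IsPureMono S a.hom.hom := by
  refine ⟨(ModuleCat.mono_iff_injective _).1 hs.mono_f, fun G _ _ _ γ => ?_⟩
  have hex : Function.Exact a.hom.hom b.hom.hom :=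
    (ShortComplex.ShortExact.moduleCat_exact_iff_function_exact _).1 hs.exact
  have hker := hex.linearMap_ker_eq
  let β : (E.obj ⧸ LinearMap.range a.hom.hom) →ₗ[S] F.obj :=
    (LinearMap.range a.hom.hom).liftQ b.hom.hom hker.ge
  have hβ : Function.Injective β := by
    rw [← LinearMap.ker_eq_bot]
    exact Submodule.ker_liftQ_eq_bot _ _ _ hker.le
  obtain ⟨C, _, k, t, htk⟩ := hfac G (β ∘ₗ γ)
  obtain ⟨t', ht'⟩ := hlift C (ObjectProperty.homMk (ModuleCat.ofHom t))
  refine ⟨t'.hom.hom ∘ₗ k, LinearMap.ext fun x => hβ ?_⟩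
  have h1 : b.hom.hom (t'.hom.hom (k x)) = t (k x) :=
    congrArg (fun f : C ⟶ F => f.hom.hom (k x)) ht'
  exact h1.trans (LinearMap.congr_fun htk x)

/-- Triangles given by split short exact sequences are split. -/
lemma isSplitTriangle_of_splitting (sp : (ShortComplex.mk a.hom b.hom w).Splitting)
    {y : E.obj ⟶ (suspData M).Q} {z : F ⟶ (suspData M).W}
    (hz : b.hom ≫ z.hom = y ≫ (suspData M).p) {Y Z : StableGProj S}
    (eY : (stab S).obj E ≅ Y) (eZ : (stab S).obj F ≅ Z) {f : (stab S).obj M ⟶ Y} {g : Y ⟶ Z}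
    {h : Z ⟶ susp ((stab S).obj M)} (hf : f = (stab S).map a ≫ eY.hom)
    (hg : eY.hom ≫ g = (stab S).map b ≫ eZ.hom) (hh : eZ.hom ≫ h = -(stab S).map z) :
    IsSplitTriangle f g h := by
  let r : E ⟶ M := ObjectProperty.homMk sp.r
  let s : F ⟶ E := ObjectProperty.homMk sp.s
  have har : a ≫ r = 𝟙 M := ObjectProperty.hom_ext _ sp.f_r
  have hsb : s ≫ b = 𝟙 F := ObjectProperty.hom_ext _ sp.s_g
  have hid : r ≫ a + b ≫ s = 𝟙 E := ObjectProperty.hom_ext _ sp.id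
  have hg' : g = eY.inv ≫ (stab S).map b ≫ eZ.hom := by rw [← hg, Iso.inv_hom_id_assoc]
  refine ⟨⟨eY.inv ≫ (stab S).map r, eZ.inv ≫ (stab S).map s ≫ eY.hom, ?_, ?_, ?_⟩, ?_⟩
  · rw [hf, Category.assoc, Iso.hom_inv_id_assoc, ← Functor.map_comp, har, (stab S).map_id]
  · rw [Category.assoc, Category.assoc, hg, ← Functor.map_comp_assoc, hsb, (stab S).map_id,
      Category.id_comp, Iso.inv_hom_id]
  · have : (stab S).map r ≫ (stab S).map a + (stab S).map b ≫ (stab S).map s = 𝟙 _ := by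
      rw [← Functor.map_comp, ← Functor.map_comp, ← Functor.map_add, hid, (stab S).map_id]
    calc _ = eY.inv ≫ ((stab S).map r ≫ (stab S).map a + (stab S).map b ≫ (stab S).map s) ≫
          eY.hom := by
          simp [hf, hg']
      _ = 𝟙 Y := by rw [this, Category.id_comp, Iso.inv_hom_id]
  -- With a section `s` of `b`, `z = s ≫ b ≫ z = s ≫ y ≫ p` factors through the projective module
  -- `Q`.
  · have h0 : (stab S).map z = 0 := by
      rw [stab_map_eq_zero_iff]
      refine ⟨(suspData M).Q, (suspData M).projective, sp.s ≫ y, (suspData M).p, ?_⟩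
      rw [Category.assoc, ← hz, ← Category.assoc, sp.s_g, Category.id_comp]
    rw [← cancel_epi eZ.hom, hh, h0, neg_zero, comp_zero]
    rfl

/-- If homomorphisms from finitely generated modules to Gorenstein-projective modules factor through
finitely generated Gorenstein-projective modules, then Gorenstein-projective modules that are
pure-injective as modules are pure-injective in the stable category. -/
lemma isPureInjectiveObject_of_module
    (hfac : ∀ (G : Type u) [AddCommGroup G] [Module S G] [Module.Finite S G] (F : GProj S)
      (g : G →ₗ[S] F.obj), ∃ (C : GProj S) (_ : Module.Finite S C.obj) (k : G →ₗ[S] C.obj)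
        (t : C.obj →ₗ[S] F.obj), t ∘ₗ k = g)
    (M : GProj S) (hM : IsPureInjectiveModule S M.obj) :
    IsPureInjectiveObject ((stab S).obj M) := by
  rintro Y Z f g h ⟨E, F, a, b, w, hs, y, z, -, hz, eY, eZ, hf, hg, hh⟩ hpure
  have hg' : g ≫ eZ.inv = eY.inv ≫ (stab S).map b := by
    rw [Iso.eq_inv_comp, ← Category.assoc, hg, Category.assoc, Iso.hom_inv_id, Category.comp_id]
  have hpm : IsPureMono S a.hom.hom := by
    refine isPureMono_of_lift hs (fun G _ _ _ => hfac G F) fun C _ t => ?_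
    -- Of the purity of the triangle only surjectivity on maps from compact objects enters.
    obtain ⟨v, hv⟩ := (hpure _ (isCompactObject_of_finite C)).2.2 ((stab S).map t ≫ eZ.hom)
    obtain ⟨v', hv'⟩ := (stab S).map_surjective (v ≫ eY.inv)
    refine exists_lift_of_stab_lift (b := b) hs.epi_g t v' ?_
    rw [hv', Category.assoc, ← hg', ← Category.assoc]
    change (v ≫ g) = _ at hv
    rw [hv, Category.assoc, Iso.hom_inv_id, Category.comp_id]
  obtain ⟨r, hr⟩ := hM _ _ _ hpm LinearMap.id
  have := hs.epi_g
  exact isSplitTriangle_of_splitting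
    (ShortComplex.Splitting.ofExactOfRetraction _ hs.exact (ModuleCat.ofHom r)
      (ModuleCat.hom_ext hr) this) hz eY eZ hf hg hh

end PureTriangles

end GorOrd

/-! ### The theorem. -/

namespace GorOrd

lemma GorensteinSetup.isPureInjectiveObject {R A ω : Type u} [CommRing R] [IsLocalRing R]
    [IsNoetherianRing R] [Ring A] [Algebra R A] [AddCommGroup ω] [Module R ω]
    (h : GorensteinSetup R A ω) (M : GProj Aᵐᵒᵖ) (hM : IsPureInjectiveModule Aᵐᵒᵖ M.obj) :
    IsPureInjectiveObject ((stab Aᵐᵒᵖ).obj M) :=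
  isPureInjectiveObject_of_module (fun G _ _ _ F g =>
    h.exists_gorensteinProjective_factorization G F g) M hM

end GorOrd

theorem lemma3p4 (R A : Type u) [CommRing R] [IsLocalRing R] (hR : GorOrd.IsCMLocalRing R)
    (ω : ModuleCat.{u} R) (hω : GorOrd.IsCanonicalModule R ω)
    [Ring A] [Algebra R A] (hA : GorOrd.IsGorensteinOrder R A ω) :
    (∀ M : GorOrd.GProj Aᵐᵒᵖ, GorOrd.IsPureInjectiveModule Aᵐᵒᵖ M.obj →
      GorOrd.IsPureInjectiveObject ((GorOrd.stab Aᵐᵒᵖ).obj M)) ∧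
    (IsAdicComplete (IsLocalRing.maximalIdeal R) R →
      ∀ M : ModuleCat.{u} Aᵐᵒᵖ, GorOrd.IsMaximalCMModule R A M →
        ∃ hM : GorOrd.IsGorensteinProjective Aᵐᵒᵖ M,
          GorOrd.IsPureInjectiveObject ((GorOrd.stab Aᵐᵒᵖ).obj ⟨M, hM⟩)) := by
  have := hR.isNoetherianRing
  -- The action on `Coind R A ω` is by definition that of `Aᵈᵐᵃ`, so the projectivity assumption
  -- transfers unchanged.
  have h : GorOrd.GorensteinSetup R A ω := ⟨hR, hω, hA.isOrder.toIsMaximalCM, hA.projective⟩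
  refine ⟨h.isPureInjectiveObject, fun _ M hM => ⟨h.isGorensteinProjective M hM,
    h.isPureInjectiveObject ⟨M, _⟩ ?_⟩⟩
  let _ := GorOrd.baseModule R A M
  have := GorOrd.baseModule_isScalarTower R A M
  have : Module.Finite R M := hM.finite
  exact GorOrd.isPureInjectiveModule_of_complete R M
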